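/- **Setting.** Let $K,P,Q\ge 1$ and $2\le k\le K$. Let $a_1\ge\cdots\ge a_K\ge 0$ with $\sum_i a_i=1$, and $\nu_k=\sum_{i=k+1}^K a_i$. Let $N_{br},N_{r1},\dots,N_{rK},N_{ipu},N_{ipe},\rho_e,R>0$ and $\varpi\in[0,1]$. For channel vectors $\mathbf h_{br},\mathbf h_{r}\in\mathbb C^{PQ}$ with independent entries, $\mathcal{CN}(0,N_{br})$ and $\mathcal{CN}(0,N_{r})$ respectively, the cascaded channel under on-off control is $\mathbf v_p^H\mathbf D_r\mathbf h_{br}$, where $\mathbf v_p$ is the $p$-th column of $\mathbf I_P\otimes\mathbf 1_Q$ and $\mathbf D_r$ is the diagonal matrix with the entries of $\mathbf h_r^H$. The ordered gain $|H_k|^2$ of user $k$ is the $k$-th smallest of $K$ independent copies of $|\mathbf v_p^H\mathbf D_{rk}\mathbf h_{br}|^2$ (with $N_r=N_{rk}$); it is independent of $h_{ipu}\sim\mathcal{CN}(0,N_{ipu})$ and $h_{ipe}\sim\mathcal{CN}(0,N_{ipe})$, which are independent of each other. The SINR of user $k$ for its own signal is $$\tilde\gamma_k=\frac{\rho|H_k|^2a_k}{\rho|H_k|^2\nu_k+\varpi\rho|h_{ipu}|^2+1}.$$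 User $1$ is the internal eavesdropper. In its SINR for the signal of user $k$ the cascaded gain is approximated by the mean $E_1=\mathbb E|\mathbf v_p^H\mathbf D_{r1}\mathbf h_{br}|^2$ of its unordered cascaded gain (with $N_r=N_{r1}$): $$\tilde\gamma_{IE\to k}=\frac{E_1a_k\rho_e}{\rho_eE_1\nu_k+\varpi\rho_e|h_{ipe}|^2+1}.$$ The (approximate) secrecy outage probability is $P_{out,k}(\rho)=\Pr\big(\big[\log_2(1+\tilde\gamma_k)-\log_2(1+\tilde\gamma_{IE\to k})\big]^+<R\big)$. Imperfect SIC (ipSIC) means $\varpi\neq 0$, and perfect SIC (pSIC) means $\varpi=0$. **Notation.** $\kappa=\frac{K!}{(K-k)!(k-1)!}$; $K_Q$ is the modified Bessel function of the second kind; $B(z)=1-\frac{2}{\Gamma(Q)}z^{Q/2}K_Q(2\sqrt z)$; $$\vartheta(\tau)=2^{R}\Big(1+\frac{QN_{br}N_{r1}a_k\rho_e}{\rho_eQN_{br}N_{r1}\nu_k+\varpi\rho_eN_{ipe}\tau+1}\Big)-1,\qquad \varsigma=2^{R}\Big(1+\frac{QN_{br}N_{r1}a_k\rho_e}{\rho_eQN_{br}N_{r1}\nu_k+1}\Big)-1,$$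 $\zeta_2=\rho N_{br}N_{rk}$ and $u(\varsigma)=\frac{\varsigma\,\zeta_2^{-1}}{a_k-\varsigma\nu_k}$. For $n\geq 0$, $L_n(x)=e^x\frac{d^n}{dx^n}(x^ne^{-x})$ is the Laguerre polynomial, $Z_n$ is the set of its zeros, and $G_n(\tau)=\frac{(n!)^2}{\tau[L_n'(\tau)]^2}$ for $\tau\in Z_n$. Assume $a_k>\varsigma\nu_k$. **Corollary 2.** Consider the high-SNR regime $\rho\to\infty$ with all other parameters fixed. (i) *ipSIC.* Let $0<\varpi\le 1$, and put $$P^{ipSIC}_{asy,k}(S,D)=\sum_{\tau_s\in Z_S}\sum_{l=0}^{K-k}\sum_{\tau_d\in Z_D}\kappa\,G_S(\tau_s)G_D(\tau_d)\binom{K-k}{l}\frac{(-1)^l}{k+l}\;B\!\left(\frac{\vartheta(\tau_s)\varpi N_{ipu}\tau_d}{(a_k-\vartheta(\tau_s)\nu_k)N_{br}N_{rk}}\right)^{k+l}.$$ Then $\lim_{\rho\to\infty}P_{out,k}(\rho)$ exists, is positive, and equals $\lim_{S,D\to\infty}P^{ipSIC}_{asy,k}(S,D)$ (joint limit). Moreover,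 for all fixed $S,D$, $P^{ipSIC}_{asy,k}(S,D)$ is the limit as $\rho\to\infty$ of the same sum with the argument of $B$ replaced by $\frac{\vartheta(\tau_s)}{a_k-\vartheta(\tau_s)\nu_k}\cdot\frac{\varpi\rho N_{ipu}\tau_d+1}{\rho N_{br}N_{rk}}$ (the approximate SOP expression at finite $\rho$). (ii) *pSIC, $Q=1$.* If $\varpi=0$ and $Q=1$, then as $\rho\to\infty$ $$P_{out,k}(\rho)\sim\frac{\kappa}{k}\Big[1-\frac{1}{\Gamma(Q)}\big\{1+u(\varsigma)\ln u(\varsigma)\big\}\Big]^k.$$ (iii) *pSIC, $Q\ge 2$.* If $\varpi=0$ and $Q\ge2$, then as $\rho\to\infty$ $$P_{out,k}(\rho)\sim\frac{\kappa}{k}\Big[\frac{\varsigma}{(Q-1)(a_k-\nu_k\varsigma)\zeta_2}\Big]^k.$$ Here $f\sim g$ means $f/g\to1$. -/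

import Mathlib

open MeasureTheory ProbabilityTheory Filter Topology

noncomputable section

namespace RisNoma

/-! ### Special functions and Gauss-Laguerre quadrature -/

/-- The modified Bessel function of the second kind, for `x > 0`:
`K_ν(x) = ∫_0^∞ exp (-x cosh t) cosh (ν t) dt`. -/
def besselK (ν x : ℝ) : ℝ :=
  ∫ t in Set.Ioi (0 : ℝ), Real.exp (-x * Real.cosh t) * Real.cosh (ν * t)

/-- The Laguerre polynomial in the normalization `L_n(x) = e^x (d/dx)^n (x^n e^{-x})`, that is
`L_n(x) = ∑_i (-1)^i (n choose i) (n! / i!) x^i`. -/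
def laguerre (n : ℕ) : Polynomial ℝ :=
  ∑ i ∈ Finset.range (n + 1),
    Polynomial.monomial i ((-1 : ℝ) ^ i * (n.choose i : ℝ) * (n.factorial : ℝ) / (i.factorial : ℝ))

/-- The finite set of the zeros of the `n`-th Laguerre polynomial (the quadrature nodes). -/
def laguerreNodes (n : ℕ) : Finset ℝ := (laguerre n).roots.toFinset

/-- The Gauss-Laguerre weight `(n!)² / (τ [L_n'(τ)]²)` at a zero `τ` of `L_n`. -/
def laguerreWeight (n : ℕ) (τ : ℝ) : ℝ :=
  (n.factorial : ℝ) ^ 2 / (τ * ((Polynomial.derivative (laguerre n)).eval τ) ^ 2)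

/-! ### Channels -/

/-- The circularly symmetric complex Gaussian law `CN(0, N)`: independent real and imaginary
parts, each centred Gaussian with variance `N / 2`. -/
def complexGaussian (N : ℝ) : Measure ℂ :=
  ((gaussianReal 0 (N / 2).toNNReal).prod (gaussianReal 0 (N / 2).toNNReal)).map
    (fun z : ℝ × ℝ => (⟨z.1, z.2⟩ : ℂ))

/-- Channel vectors: `M = P Q` entries, indexed by block and position in the block. -/
abbrev ChannelVec (P Q : ℕ) : Type := Fin P × Fin Q → ℂ

/-- The joint law of the pair `(h_br, h_r)`: all entries independent, those of `h_br` with law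
`CN(0, Nbr)` and those of `h_r` with law `CN(0, Nr)`. -/
def channelLaw (P Q : ℕ) (Nbr Nr : ℝ) : Measure (ChannelVec P Q × ChannelVec P Q) :=
  (Measure.pi fun _ => complexGaussian Nbr).prod (Measure.pi fun _ => complexGaussian Nr)

/-- The on-off control matrix `V = I_P ⊗ 1_Q`. -/
def onOffMatrix (P Q : ℕ) : Matrix (Fin P × Fin Q) (Fin P × Fin 1) ℂ :=
  Matrix.kroneckerMap (· * ·) (1 : Matrix (Fin P) (Fin P) ℂ)
    (Matrix.of fun (_ : Fin Q) (_ : Fin 1) => (1 : ℂ))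

/-- The cascaded channel `v_pᴴ D_r h_br` under on-off control, where `v_p` is the `p`-th column of
`V` and `D_r` is the diagonal matrix with the entries of `h_rᴴ`. -/
def cascadedChannel {P Q : ℕ} (p : Fin P) (hbr hr : ChannelVec P Q) : ℂ :=
  star (fun m => onOffMatrix P Q m (p, 0)) ⬝ᵥ (Matrix.diagonal (star hr)).mulVec hbr

/-- The unordered cascaded channel gain `|v_pᴴ D_r h_br|²`. -/
def cascadedGain {P Q : ℕ} (p : Fin P) (h : ChannelVec P Q × ChannelVec P Q) : ℝ :=
  ‖cascadedChannel p h.1 h.2‖ ^ 2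

/-- The `k`-th smallest of the numbers `x 0, …, x (K - 1)`, for `1 ≤ k ≤ K`. -/
def orderStat {K : ℕ} (x : Fin K → ℝ) (k : ℕ) : ℝ :=
  sInf {t : ℝ | k ≤ (Finset.univ.filter fun i => x i ≤ t).card}

/-! ### The network -/

/-- Numerical parameters of the network. Users are numbered from `1` to `K`. -/
structure Params where
  /-- number of users -/
  K : ℕ
  /-- number of blocks of reflecting elements -/
  P : ℕ
  /-- number of elements in a block; the surface has `P * Q` elements -/
  Q : ℕ
  /-- the block that is switched on -/
  p : Fin P
  /-- power allocation factors `a 1, …, a K` -/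
  a : ℕ → ℝ
  /-- variance of the entries of the channel from the base station to the surface -/
  Nbr : ℝ
  /-- variance of the entries of the channel from the surface to user `i` -/
  Nr : ℕ → ℝ
  /-- mean power of the residual interference at the legitimate user -/
  Nipu : ℝ
  /-- mean power of the residual interference at the eavesdropper -/
  Nipe : ℝ
  /-- transmit SNR of the eavesdropping channel -/
  ρe : ℝ

/-- The standing assumptions on the parameters. -/
structure Params.Valid (c : Params) : Prop where
  one_le_Q : 1 ≤ c.Q
  a_nonneg : ∀ i, 1 ≤ i → i ≤ c.K → 0 ≤ c.a i
  a_antitone : ∀ i j, 1 ≤ i → i ≤ j → j ≤ c.K → c.a j ≤ c.a i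
  a_sum : ∑ i ∈ Finset.Icc 1 c.K, c.a i = 1
  Nbr_pos : 0 < c.Nbr
  Nr_pos : ∀ i, 1 ≤ i → i ≤ c.K → 0 < c.Nr i
  Nipu_pos : 0 < c.Nipu
  Nipe_pos : 0 < c.Nipe
  ρe_pos : 0 < c.ρe

namespace Params

variable (c : Params)

/-- `ν_k = ∑_{i = k+1}^K a_i`. -/
def ν (k : ℕ) : ℝ := ∑ i ∈ Finset.Icc (k + 1) c.K, c.a i

/-- A realization of all fading coefficients that are relevant for user `k`: one pair of channel
vectors for each of the `K` independent copies of its unordered cascaded channel, then `h_ipu`,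
then `h_ipe`. -/
abbrev Sample : Type :=
  (Fin c.K → ChannelVec c.P c.Q × ChannelVec c.P c.Q) × (ℂ × ℂ)

/-- The law of the fading coefficients: everything is independent. -/
def law (k : ℕ) : Measure c.Sample :=
  (Measure.pi fun _ : Fin c.K => channelLaw c.P c.Q c.Nbr (c.Nr k)).prod
    ((complexGaussian c.Nipu).prod (complexGaussian c.Nipe))

/-- The ordered cascaded gain `|H_k|²` of user `k`: the `k`-th smallest of `K` independent copies
of the unordered one. Its distribution function is
`κ ∑_l (K - k choose l) (-1)^l / (k + l) F^{k + l}`, with `F` that of the unordered gain. -/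
def orderedGain (k : ℕ) (ω : c.Sample) : ℝ :=
  orderStat (fun i => cascadedGain c.p (ω.1 i)) k

/-- The SINR of user `k` for its own signal, at transmit SNR `ρ` and residual interference
level `ϖ`. -/
def sinrUser (ϖ ρ : ℝ) (k : ℕ) (ω : c.Sample) : ℝ :=
  ρ * c.orderedGain k ω * c.a k /
    (ρ * c.orderedGain k ω * c.ν k + ϖ * ρ * ‖ω.2.1‖ ^ 2 + 1)

/-- The mean `E(|H_1|²)` of the unordered cascaded gain of user `1`, the internal eavesdropper. -/
def meanGainEve : ℝ :=
  ∫ h, cascadedGain c.p h ∂(channelLaw c.P c.Q c.Nbr (c.Nr 1))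

/-- The SINR of the internal eavesdropper for the signal of user `k`, with its cascaded gain
replaced by the mean `E(|H_1|²)`. -/
def sinrEve (ϖ : ℝ) (k : ℕ) (ω : c.Sample) : ℝ :=
  c.meanGainEve * c.a k * c.ρe /
    (c.ρe * c.meanGainEve * c.ν k + ϖ * c.ρe * ‖ω.2.2‖ ^ 2 + 1)

/-- The secrecy rate `max (log₂ (1 + γ) - log₂ (1 + γ_E)) 0` of user `k`. -/
def secrecyRate (ϖ ρ : ℝ) (k : ℕ) (ω : c.Sample) : ℝ :=
  max (Real.logb 2 (1 + c.sinrUser ϖ ρ k ω) - Real.logb 2 (1 + c.sinrEve ϖ k ω)) 0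

/-- The secrecy outage probability of user `k` for the target secrecy rate `R` under internal
eavesdropping, as a function of `ρ`. The gain of the eavesdropper enters through its mean. -/
def sop (ϖ R : ℝ) (k : ℕ) (ρ : ℝ) : ℝ :=
  (c.law k).real {ω | c.secrecyRate ϖ ρ k ω < R}

/-! ### The closed forms -/

/-- `κ = K! / ((K - k)! (k - 1)!)`. -/
def κ (k : ℕ) : ℝ :=
  (c.K.factorial : ℝ) / (((c.K - k).factorial : ℝ) * ((k - 1).factorial : ℝ))

/-- `ϑ(τ) = 2^R (1 + Q Nbr Nr1 a_k ρe / (ρe Q Nbr Nr1 ν_k + ϖ ρe Nipe τ + 1)) - 1`. -/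
def vartheta (ϖ R : ℝ) (k : ℕ) (τ : ℝ) : ℝ :=
  (2 : ℝ) ^ R * (1 + c.Q * c.Nbr * c.Nr 1 * c.a k * c.ρe /
    (c.ρe * c.Q * c.Nbr * c.Nr 1 * c.ν k + ϖ * c.ρe * c.Nipe * τ + 1)) - 1

/-- `ς = 2^R (1 + Q Nbr Nr1 a_k ρe / (ρe Q Nbr Nr1 ν_k + 1)) - 1`. -/
def varsigma (R : ℝ) (k : ℕ) : ℝ :=
  (2 : ℝ) ^ R * (1 + c.Q * c.Nbr * c.Nr 1 * c.a k * c.ρe /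
    (c.ρe * c.Q * c.Nbr * c.Nr 1 * c.ν k + 1)) - 1

/-- `1 - (2 / Γ(Q)) z^{Q/2} K_Q(2 √z)`. -/
def bracket (z : ℝ) : ℝ :=
  1 - 2 / Real.Gamma c.Q * z ^ ((c.Q : ℝ) / 2) * besselK c.Q (2 * Real.sqrt z)

/-- The approximate SOP expression with imperfect SIC, at finite `ρ`, with `S` and `D` quadrature
nodes; here `ζ₁ = (ϖ ρ Nipu τ_d + 1) / (ρ Nbr Nrk)`. -/
def sopApprox (ϖ R : ℝ) (k S D : ℕ) (ρ : ℝ) : ℝ :=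
  ∑ τs ∈ laguerreNodes S, ∑ l ∈ Finset.range (c.K - k + 1), ∑ τd ∈ laguerreNodes D,
    c.κ k * laguerreWeight S τs * laguerreWeight D τd * ((c.K - k).choose l : ℝ) *
      ((-1 : ℝ) ^ l / ((k : ℝ) + l)) *
      c.bracket (c.vartheta ϖ R k τs * ((ϖ * ρ * c.Nipu * τd + 1) / (ρ * c.Nbr * c.Nr k)) /
        (c.a k - c.vartheta ϖ R k τs * c.ν k)) ^ (k + l)

/-- The asymptotic SOP expression with imperfect SIC, with `S` and `D` quadrature nodes. -/
def sopAsyIpsic (ϖ R : ℝ) (k S D : ℕ) : ℝ :=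
  ∑ τs ∈ laguerreNodes S, ∑ l ∈ Finset.range (c.K - k + 1), ∑ τd ∈ laguerreNodes D,
    c.κ k * laguerreWeight S τs * laguerreWeight D τd * ((c.K - k).choose l : ℝ) *
      ((-1 : ℝ) ^ l / ((k : ℝ) + l)) *
      c.bracket (c.vartheta ϖ R k τs * ϖ * c.Nipu * τd /
        ((c.a k - c.vartheta ϖ R k τs * c.ν k) * c.Nbr * c.Nr k)) ^ (k + l)

/-- `ζ₂ = ρ Nbr Nrk`. -/
def ζ₂ (k : ℕ) (ρ : ℝ) : ℝ := ρ * c.Nbr * c.Nr k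

/-- `u(ς) = ς ζ₂⁻¹ / (a_k - ς ν_k)`. -/
def u (R : ℝ) (k : ℕ) (ρ : ℝ) : ℝ :=
  c.varsigma R k * (c.ζ₂ k ρ)⁻¹ / (c.a k - c.varsigma R k * c.ν k)

/-- The asymptotic SOP expression with perfect SIC for `Q = 1`. -/
def sopAsyPsicOne (R : ℝ) (k : ℕ) (ρ : ℝ) : ℝ :=
  c.κ k / k * (1 - 1 / Real.Gamma c.Q * (1 + c.u R k ρ * Real.log (c.u R k ρ))) ^ k

/-- The asymptotic SOP expression with perfect SIC for `Q ≥ 2`. -/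
def sopAsyPsicTwo (R : ℝ) (k : ℕ) (ρ : ℝ) : ℝ :=
  c.κ k / k * (c.varsigma R k /
    (((c.Q : ℝ) - 1) * (c.a k - c.ν k * c.varsigma R k) * c.ζ₂ k ρ)) ^ k

end Params

end RisNoma

end

/-! Given the two residual interference powers, outage means that the ordered gain lies below a
threshold (`Params.Valid.secrecyRate_lt_iff`). The rate inequality is affine in the gain, and `a_k >
ς ν_k` keeps its coefficient positive at every interference level, because `ς` bounds every `ϑ(τ)`
with `τ ≥ 0`. Given `h_r`, the cascaded channel is complex Gaussian with variance proportional to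
the energy of `h_r` on the active block. So the unordered gain is, up to scale, a Gamma variable of
shape `Q` times an independent exponential (`map_cascadedGain_channelLaw`). Its distribution
function is the Bessel expression (`bracket_eq_gainCdf`), and that of the order statistic is a
polynomial in it (`binomialTail_eq_orderCdf`). The outage probability is thus an integral over two
independent unit exponentials of a function with values in `[0, 1]` (`Params.Valid.sop_eq`).

With imperfect SIC the threshold converges pointwise as `ρ → ∞`, to a positive limit almost
everywhere. Dominated convergence identifies the limit of the probability, which is positive. The
closed form is the tensor Gauss-Laguerre rule applied to the limiting integrand. The rule has
positive weights and is exact in degree below `2n`, so each of its moments eventually equals that of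
the exponential law. This forces convergence of characteristic functions
(`tendsto_integral_pow_mul_exp`), hence weak convergence of the rules and of their products, which
gives the joint limit.

With perfect SIC the interference disappears and the probability is the ordered distribution
function at `u(ς)`, which tends to `0`. There the order statistic contributes `(κ/k) x^k`. For `Q ≥
2` the Gamma variable has inverse moment `1/(Q-1)`, so the gain has distribution function equivalent
to `u/(Q-1)`. For `Q = 1` that moment diverges logarithmically, which produces `-u log u`. -/

namespace RisNoma

/-! ### Laguerre polynomials and exactness of Gauss-Laguerre quadrature. -/

section Laguerre

open Polynomial Finset

/-- The linear functional `x ^ i ↦ i!` on polynomials, i.e. integration against `e^{-x}` on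
`(0, ∞)`. -/
noncomputable def factorialMoment : ℝ[X] →ₗ[ℝ] ℝ :=
  Polynomial.lsum fun i => (i.factorial : ℝ) • LinearMap.id

lemma factorialMoment_monomial (i : ℕ) (a : ℝ) :
    factorialMoment (monomial i a) = a * i.factorial := by
  simp [factorialMoment, Polynomial.lsum_apply, Polynomial.sum_monomial_index, mul_comm]

lemma integral_pow_mul_exp_neg (i : ℕ) :
    IntegrableOn (fun x : ℝ => x ^ i * Real.exp (-x)) (Set.Ioi 0) ∧
      ∫ x in Set.Ioi (0 : ℝ), x ^ i * Real.exp (-x) = i.factorial := by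
  have h : (fun x : ℝ => x ^ i * Real.exp (-x)) =
      fun x : ℝ => Real.exp (-x) * x ^ (((i : ℝ) + 1) - 1) := by
    ext x; simp [mul_comm]
  have hi : (0 : ℝ) < (i : ℝ) + 1 := by positivity
  rw [h]
  exact ⟨Real.GammaIntegral_convergent hi, by
    rw [← Real.Gamma_eq_integral hi, Real.Gamma_nat_eq_factorial]⟩

lemma factorialMoment_eq_integral (p : ℝ[X]) :
    IntegrableOn (fun x : ℝ => p.eval x * Real.exp (-x)) (Set.Ioi 0) ∧
      factorialMoment p = ∫ x in Set.Ioi (0 : ℝ), p.eval x * Real.exp (-x) := by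
  induction p using Polynomial.induction_on' with
  | add p q hp hq =>
    have h : (fun x : ℝ => (p + q).eval x * Real.exp (-x)) =
        fun x => p.eval x * Real.exp (-x) + q.eval x * Real.exp (-x) := by
      ext x; simp [add_mul]
    rw [h, integral_add hp.1 hq.1, map_add, hp.2, hq.2]
    exact ⟨hp.1.add hq.1, rfl⟩
  | monomial i a =>
    have h : (fun x : ℝ => (monomial i a).eval x * Real.exp (-x)) =
        fun x => a * (x ^ i * Real.exp (-x)) := by
      ext x; simp [mul_assoc]
    rw [h, integral_const_mul, (integral_pow_mul_exp_neg i).2, factorialMoment_monomial]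
    exact ⟨(integral_pow_mul_exp_neg i).1.const_mul a, rfl⟩

/-- Integration by parts against `e^{-x}`, with boundary term at `0`. It is used to evaluate the
quadrature weights. -/
lemma factorialMoment_derivative (p : ℝ[X]) :
    factorialMoment (derivative p) = factorialMoment p - p.eval 0 := by
  induction p using Polynomial.induction_on' with
  | add p q hp hq => simp only [map_add, hp, hq, eval_add]; ring
  | monomial i a =>
    rw [derivative_monomial, factorialMoment_monomial, factorialMoment_monomial]
    cases i with
    | zero => simp
    | succ i => simp [Nat.factorial_succ]; ring

/-- A nonzero polynomial vanishes only at finitely many points, so the integrand is nonzero almost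
everywhere on the half-line. -/
lemma factorialMoment_pos {p : ℝ[X]} (hp : p ≠ 0) (h : ∀ x, 0 ≤ p.eval x) :
    0 < factorialMoment p := by
  obtain ⟨hi, he⟩ := factorialMoment_eq_integral p
  rw [he, integral_pos_iff_support_of_nonneg _ hi]
  · have hs : (Set.Ioi (0 : ℝ)) \ (p.roots.toFinset : Set ℝ) ⊆
        Function.support (fun x : ℝ => p.eval x * Real.exp (-x)) := by
      intro x hx
      have h2 : ¬ p.eval x = 0 := by
        intro h0
        exact hx.2 (by simpa [hp] using h0)
      simpa using h2
    have hm : volume (Set.Ioi (0 : ℝ) \ (p.roots.toFinset : Set ℝ)) = ⊤ := by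
      rw [measure_sdiff_null (Finset.measure_zero _ _)]
      simp
    rw [Measure.restrict_apply' measurableSet_Ioi]
    refine lt_of_lt_of_le (b := volume (Set.Ioi (0 : ℝ) \ (p.roots.toFinset : Set ℝ))) ?_
      (measure_mono fun x hx => ⟨hs hx, hx.1⟩)
    rw [hm]; simp
  · intro x
    exact mul_nonneg (h x) (Real.exp_pos _).le

lemma laguerre_coeff (n i : ℕ) : (laguerre n).coeff i =
    (-1 : ℝ) ^ i * (n.choose i : ℝ) * (n.factorial : ℝ) / (i.factorial : ℝ) := by
  simp only [laguerre, finsetSum_coeff, coeff_monomial]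
  rw [Finset.sum_ite_eq' (Finset.range (n + 1)) i]
  split_ifs with h
  · rfl
  · rw [Nat.choose_eq_zero_of_lt (by simpa using h)]; simp

lemma laguerre_coeff_self_ne_zero (n : ℕ) : (laguerre n).coeff n ≠ 0 := by
  rw [laguerre_coeff]
  have : (n.factorial : ℝ) ≠ 0 := by positivity
  simp [this]

lemma laguerre_ne_zero (n : ℕ) : laguerre n ≠ 0 := by
  intro h
  exact laguerre_coeff_self_ne_zero n (by simp [h])

lemma natDegree_laguerre (n : ℕ) : (laguerre n).natDegree = n := by
  refine natDegree_eq_of_le_of_coeff_ne_zero ?_ (laguerre_coeff_self_ne_zero n)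
  refine natDegree_sum_le_of_forall_le _ _ fun i hi => ?_
  exact (natDegree_monomial_le _).trans (by simpa [Nat.lt_succ_iff] using hi)

lemma laguerre_eval_zero (n : ℕ) : (laguerre n).eval 0 = n.factorial := by
  rw [← coeff_zero_eq_eval_zero, laguerre_coeff]; simp

/-- The coefficients alternate in sign, so at `x ≤ 0` no term is negative, and the constant term is
`n!`. Hence all nodes are positive. -/
lemma laguerre_eval_pos {n : ℕ} {x : ℝ} (hx : x ≤ 0) : 0 < (laguerre n).eval x := by
  simp only [laguerre, eval_finsetSum, eval_monomial]
  refine Finset.sum_pos' (fun i _ => ?_) ⟨0, by simp, by simp; positivity⟩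
  have : (-1 : ℝ) ^ i * (n.choose i : ℝ) * (n.factorial : ℝ) / (i.factorial : ℝ) * x ^ i =
      (n.choose i : ℝ) * (n.factorial : ℝ) / (i.factorial : ℝ) * (-x) ^ i := by
    rw [neg_pow]; ring
  rw [this]
  have : 0 ≤ -x := by linarith
  positivity

/-- Up to the factor `±n!`, this moment is the `n`-th forward difference at `0` of the polynomial
`(x+1)⋯(x+m)`, whose values at integers are `(i+m)!/i!`. Its degree `m` is below `n`, so the
difference vanishes. -/
lemma factorialMoment_laguerre_mul_X_pow {m n : ℕ} (h : m < n) :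
    factorialMoment (laguerre n * X ^ m) = 0 := by
  have h1 : factorialMoment (laguerre n * X ^ m) = ∑ i ∈ range (n + 1),
      (-1 : ℝ) ^ i * (n.choose i : ℝ) * (n.factorial : ℝ) *
        ((i + m).factorial / i.factorial : ℝ) := by
    simp only [laguerre, sum_mul, map_sum, monomial_mul_X_pow, factorialMoment_monomial]
    exact sum_congr rfl fun i _ => by ring
  have h2 := congr_fun (Polynomial.fwdDiff_iter_eq_zero_of_degree_lt
    (P := ((ascPochhammer ℝ m).comp (X + 1))) (n := n) (by
      rw [natDegree_comp, ascPochhammer_natDegree]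
      have : (X + 1 : ℝ[X]).natDegree = 1 := natDegree_X_add_C 1
      rw [this]; simpa using h)) 0
  rw [fwdDiff_iter_eq_sum_shift] at h2
  have h3 : ∀ i : ℕ, ((ascPochhammer ℝ m).comp (X + 1)).eval (0 + i • (1 : ℝ)) =
      ((i + m).factorial / i.factorial : ℝ) := by
    intro i
    rw [eq_div_iff (by positivity), eval_comp]
    have : eval (0 + i • (1 : ℝ)) (X + 1 : ℝ[X]) = ((i + 1 : ℕ) : ℝ) := by simp
    rw [this, ← ascPochhammer_eval_cast, ascPochhammer_nat_eq_ascFactorial, mul_comm]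
    exact_mod_cast Nat.factorial_mul_ascFactorial i m
  simp only [h3, Pi.zero_apply, zsmul_eq_mul] at h2
  push_cast at h2
  rw [h1]
  have h4 : ∑ i ∈ range (n + 1), (-1 : ℝ) ^ i * (n.choose i : ℝ) * (n.factorial : ℝ) *
        ((i + m).factorial / i.factorial : ℝ) = (n.factorial : ℝ) * (-1) ^ n *
      ∑ i ∈ range (n + 1), (-1 : ℝ) ^ (n - i) * (n.choose i : ℝ) *
        ((i + m).factorial / i.factorial : ℝ) := by
    rw [mul_sum]
    refine sum_congr rfl fun i hi => ?_
    have hin : i ≤ n := by simpa [Nat.lt_succ_iff] using hi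
    have : (-1 : ℝ) ^ i = (-1) ^ n * (-1) ^ (n - i) := by
      rw [← pow_add]
      obtain ⟨j, rfl⟩ := Nat.exists_eq_add_of_le hin
      rw [show i + j + (i + j - i) = i + 2 * j by omega, pow_add, pow_mul]; simp
    rw [this]; ring
  rw [h4, h2, mul_zero]

/-- Laguerre polynomials are orthogonal to all polynomials of smaller degree. -/
lemma factorialMoment_laguerre_mul {n : ℕ} {p : ℝ[X]} (h : p.degree < n) :
    factorialMoment (laguerre n * p) = 0 := by
  rcases eq_or_ne p 0 with rfl | hp
  · simp
  · rw [p.as_sum_range_C_mul_X_pow' ((natDegree_lt_iff_degree_lt hp).2 h), mul_sum, map_sum]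
    refine sum_eq_zero fun i hi => ?_
    rw [← smul_eq_C_mul, mul_smul_comm, map_smul,
      factorialMoment_laguerre_mul_X_pow (mem_range.1 hi), smul_zero]

lemma mem_laguerreNodes {n : ℕ} {τ : ℝ} : τ ∈ laguerreNodes n ↔ (laguerre n).eval τ = 0 := by
  simp [laguerreNodes, laguerre_ne_zero]

lemma laguerreNodes_pos {n : ℕ} {τ : ℝ} (h : τ ∈ laguerreNodes n) : 0 < τ := by
  by_contra! h0
  exact (laguerre_eval_pos h0).ne' (mem_laguerreNodes.1 h)

/-- If `L_n = (X-τ)² g`, then `L_n g = ((X-τ) g)²` has positive moment, while `deg g = n - 2` makes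
it orthogonal to `L_n`. -/
lemma not_sq_dvd_laguerre (n : ℕ) (τ : ℝ) : ¬ (X - C τ) ^ 2 ∣ laguerre n := by
  rintro ⟨g, hg⟩
  have hg0 : g ≠ 0 := by
    rintro rfl
    exact laguerre_ne_zero n (by simpa using hg)
  have hX : (X - C τ : ℝ[X]) ≠ 0 := X_sub_C_ne_zero τ
  have hdeg : n = 2 + g.natDegree := by
    have := congr_arg natDegree hg
    rw [natDegree_laguerre, natDegree_mul (pow_ne_zero _ hX) hg0, natDegree_pow,
      natDegree_X_sub_C] at this
    omega
  have h0 : factorialMoment (laguerre n * g) = 0 :=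
    factorialMoment_laguerre_mul ((natDegree_lt_iff_degree_lt hg0).1 (by omega))
  have hpos : 0 < factorialMoment (laguerre n * g) := by
    rw [hg, show (X - C τ) ^ 2 * g * g = ((X - C τ) * g) ^ 2 by ring]
    exact factorialMoment_pos (pow_ne_zero _ (mul_ne_zero hX hg0)) fun x => by
      rw [eval_pow]; positivity
  exact hpos.ne' h0

lemma nodup_roots_laguerre (n : ℕ) : (laguerre n).roots.Nodup := by
  rw [Multiset.nodup_iff_count_le_one]
  intro τ
  rw [count_roots]
  by_contra! h
  exact not_sq_dvd_laguerre n τ ((le_rootMultiplicity_iff (laguerre_ne_zero n)).1 h)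

lemma eval_mul_eval_pos_of_roots_eq_zero {q : ℝ[X]} (hq : q ≠ 0) (h : q.roots = 0) (x y : ℝ) :
    0 < q.eval x * q.eval y := by
  have hne : ∀ z, q.eval z ≠ 0 := fun z hz => by
    have : z ∈ q.roots := (mem_roots hq).2 hz
    simp [h] at this
  by_contra! hxy
  have : (0 : ℝ) ∈ Set.range fun z => q.eval z := by
    rcases mul_nonpos_iff.1 hxy with h1 | h1
    · exact mem_range_of_exists_le_of_exists_ge q.continuous ⟨y, h1.2⟩ ⟨x, h1.1⟩
    · exact mem_range_of_exists_le_of_exists_ge q.continuous ⟨x, h1.1⟩ ⟨y, h1.2⟩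
  obtain ⟨z, hz⟩ := this
  exact hne z hz

/-- Write `L_n = p q` with `p` the product over the real roots and `q` without real roots, hence of
constant sign. With fewer than `n` roots, `p` is orthogonal to `L_n`, yet `q(0) L_n p = q(0) q p²`
is nonnegative and nonzero. -/
lemma card_roots_laguerre (n : ℕ) : Multiset.card (laguerre n).roots = n := by
  obtain ⟨q, hq, hcard, hroots⟩ := (laguerre n).exists_prod_multiset_X_sub_C_mul
  rw [natDegree_laguerre] at hcard
  by_contra hne
  set p : ℝ[X] := ((laguerre n).roots.map fun a => X - C a).prod with hp
  have hpm : p.Monic := monic_multiset_prod_of_monic _ _ fun a _ => monic_X_sub_C a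
  have hpd : p.natDegree = Multiset.card (laguerre n).roots :=
    natDegree_multiset_prod_X_sub_C_eq_card _
  have hq0 : q ≠ 0 := by
    rintro rfl
    exact laguerre_ne_zero n (by rw [← hq, mul_zero])
  have h0 : factorialMoment (laguerre n * p) = 0 :=
    factorialMoment_laguerre_mul ((natDegree_lt_iff_degree_lt hpm.ne_zero).1 (by omega))
  have hpos : 0 < factorialMoment (q.eval 0 • (laguerre n * p)) := by
    refine factorialMoment_pos (smul_ne_zero ?_ (mul_ne_zero (laguerre_ne_zero n) hpm.ne_zero))
      fun x => ?_
    · have := eval_mul_eval_pos_of_roots_eq_zero hq0 hroots 0 0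
      exact fun h => by simp [h] at this
    · have := eval_mul_eval_pos_of_roots_eq_zero hq0 hroots 0 x
      rw [← hq, eval_smul, eval_mul, eval_mul, smul_eq_mul,
        show q.eval 0 * (p.eval x * q.eval x * p.eval x) =
          (q.eval 0 * q.eval x) * p.eval x ^ 2 by ring]
      positivity
  rw [map_smul, h0, smul_zero] at hpos
  exact hpos.false

lemma card_laguerreNodes (n : ℕ) : (laguerreNodes n).card = n := by
  rw [laguerreNodes, Multiset.toFinset_card_of_nodup (nodup_roots_laguerre n),
    card_roots_laguerre]

lemma derivative_laguerre_ne_zero {n : ℕ} {τ : ℝ} (h : τ ∈ laguerreNodes n) :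
    (derivative (laguerre n)).eval τ ≠ 0 := by
  intro h0
  have hr : (laguerre n).IsRoot τ := mem_laguerreNodes.1 h
  have := (one_lt_rootMultiplicity_iff_isRoot (laguerre_ne_zero n)).2 ⟨hr, h0⟩
  exact not_sq_dvd_laguerre n τ ((le_rootMultiplicity_iff (laguerre_ne_zero n)).1 this)

lemma laguerreWeight_pos {n : ℕ} {τ : ℝ} (h : τ ∈ laguerreNodes n) : 0 < laguerreWeight n τ := by
  have h1 := laguerreNodes_pos h
  have h2 := derivative_laguerre_ne_zero h
  rw [laguerreWeight]
  positivity

/-- Gauss's argument: divide `p` by `L_n`. The quotient has degree below `n`, so orthogonality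
removes its contribution. The remainder agrees with `p` at the nodes and equals its own Lagrange
interpolant. -/
lemma factorialMoment_eq_sum_basis {n : ℕ} {p : ℝ[X]} (hp : p.degree < (2 * n : ℕ)) :
    factorialMoment p = ∑ τ ∈ laguerreNodes n,
      factorialMoment (Lagrange.basis (laguerreNodes n) id τ) * p.eval τ := by
  have hL := laguerre_ne_zero n
  have hLd : (laguerre n).degree = n := by rw [degree_eq_natDegree hL, natDegree_laguerre]
  have hdiv : (p / laguerre n).degree < n := by
    rcases lt_or_ge p.degree (laguerre n).degree with h | h
    · rw [(Polynomial.div_eq_zero_iff hL).2 h, degree_zero]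
      exact WithBot.bot_lt_coe _
    · have h1 := Polynomial.degree_add_div hL h
      have hp0 : p ≠ 0 := by rintro rfl; simp [hLd] at h
      have hq0 : p / laguerre n ≠ 0 := by
        rw [Ne, Polynomial.div_eq_zero_iff hL]; exact not_lt.2 h
      rw [degree_eq_natDegree hp0] at h1 hp
      rw [hLd, degree_eq_natDegree hq0] at h1
      rw [degree_eq_natDegree hq0]
      norm_cast at *
      omega
  have hmod : (p % laguerre n).degree < (laguerreNodes n).card := by
    rw [card_laguerreNodes, ← hLd]
    exact Polynomial.degree_mod_lt p hL
  have heval : ∀ τ ∈ laguerreNodes n, (p % laguerre n).eval τ = p.eval τ := fun τ hτ => by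
    conv_rhs => rw [← EuclideanDomain.div_add_mod p (laguerre n)]
    rw [eval_add, eval_mul, mem_laguerreNodes.1 hτ, zero_mul, zero_add]
  conv_lhs => rw [← EuclideanDomain.div_add_mod p (laguerre n)]
  rw [map_add, factorialMoment_laguerre_mul hdiv, zero_add,
    Lagrange.eq_interpolate (s := laguerreNodes n) (v := id) Function.injective_id.injOn hmod,
    Lagrange.interpolate_apply, map_sum]
  refine sum_congr rfl fun τ hτ => ?_
  rw [← smul_eq_C_mul, map_smul, smul_eq_mul, id, heval τ hτ, mul_comm]

/-- Test the rule on `q L_n'` with `q = L_n/(X-τ)`. Since `q` vanishes at the other nodes and `q(τ)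
= L_n'(τ)`, only the weight at `τ` times `L_n'(τ)²` survives. -/
lemma factorialMoment_basis_eq_laguerreWeight {n : ℕ} {τ : ℝ} (h : τ ∈ laguerreNodes n) :
    factorialMoment (Lagrange.basis (laguerreNodes n) id τ) = laguerreWeight n τ := by
  have hτ := laguerreNodes_pos h
  have hL := laguerre_ne_zero n
  obtain ⟨q, hq⟩ : X - C τ ∣ laguerre n := dvd_iff_isRoot.2 (mem_laguerreNodes.1 h)
  have hX : (X - C τ : ℝ[X]) ≠ 0 := X_sub_C_ne_zero τ
  have hq0 : q ≠ 0 := by rintro rfl; exact hL (by simpa using hq)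
  have hdeg : n = 1 + q.natDegree := by
    have := congr_arg natDegree hq
    rwa [natDegree_laguerre, natDegree_mul hX hq0, natDegree_X_sub_C] at this
  have hqd : q.degree < n := (natDegree_lt_iff_degree_lt hq0).1 (by omega)
  have hder : derivative (laguerre n) = q + (X - C τ) * derivative q := by
    conv_lhs => rw [hq]
    rw [derivative_mul]; simp
  have hqτ : q.eval τ = (derivative (laguerre n)).eval τ := by rw [hder]; simp
  -- By parts the moment is `-L_n(0) q(0)`, the other terms being killed by orthogonality; moreover
  -- `-τ q(0) = L_n(0) = n!`.
  have hparts : factorialMoment (q * derivative (laguerre n)) = (n.factorial : ℝ) ^ 2 / τ := by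
    have h1 := factorialMoment_derivative (laguerre n * q)
    have h2 : factorialMoment (laguerre n * q) = 0 := factorialMoment_laguerre_mul hqd
    have h3 : factorialMoment (laguerre n * derivative q) = 0 :=
      factorialMoment_laguerre_mul (lt_of_le_of_lt (degree_derivative_le) hqd)
    rw [derivative_mul, map_add, h2, h3, add_zero, eval_mul, laguerre_eval_zero,
      mul_comm] at h1
    have h4 := laguerre_eval_zero n
    rw [hq, eval_mul] at h4
    simp only [eval_sub, eval_X, eval_C, zero_sub] at h4
    rw [h1, eq_div_iff hτ.ne', ← h4]; ring
  have hquad := factorialMoment_eq_sum_basis (n := n) (p := q * derivative (laguerre n)) (by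
    refine degree_le_natDegree.trans_lt (WithBot.coe_lt_coe.2 ?_)
    refine natDegree_mul_le.trans_lt ?_
    have := natDegree_derivative_le (laguerre n)
    rw [natDegree_laguerre] at this
    rw [Nat.cast_id]
    omega)
  rw [hparts, sum_eq_single_of_mem τ h] at hquad
  · have hne := derivative_laguerre_ne_zero h
    rw [eval_mul, hqτ] at hquad
    rw [laguerreWeight, ← div_div, hquad]
    field_simp
  · intro σ hσ hne
    have : q.eval σ = 0 := by
      have h5 := mem_laguerreNodes.1 hσ
      rw [hq, eval_mul] at h5
      rcases mul_eq_zero.1 h5 with h6 | h6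
      · exact absurd (by simpa [sub_eq_zero] using h6) hne
      · exact h6
    rw [eval_mul, this]; simp

/-- Gauss-Laguerre quadrature is exact for polynomials of degree less than `2 n`. -/
theorem sum_laguerreWeight_mul_eval {n : ℕ} {p : ℝ[X]} (hp : p.degree < (2 * n : ℕ)) :
    ∑ τ ∈ laguerreNodes n, laguerreWeight n τ * p.eval τ = factorialMoment p := by
  rw [factorialMoment_eq_sum_basis hp]
  exact sum_congr rfl fun τ hτ => by rw [factorialMoment_basis_eq_laguerreWeight hτ]

theorem sum_laguerreWeight_mul_pow {n j : ℕ} (hj : j < 2 * n) :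
    ∑ τ ∈ laguerreNodes n, laguerreWeight n τ * τ ^ j = j.factorial := by
  have := sum_laguerreWeight_mul_eval (n := n) (p := monomial j (1 : ℝ))
    ((degree_monomial_le _ _).trans_lt (by exact_mod_cast hj))
  simpa [factorialMoment_monomial] using this

end Laguerre

/-! ### Weak convergence of the quadrature rules to the exponential law. -/

section Quadrature

/-- The integral form of the Gamma law with unit rate. -/
lemma gammaMeasure_eq_withDensity (a : ℝ) : gammaMeasure a 1 =
    (volume.restrict (Set.Ioi 0)).withDensity
      (fun x => ENNReal.ofReal (x ^ (a - 1) * Real.exp (-x) / Real.Gamma a)) := by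
  rw [gammaMeasure, restrict_Ioi_eq_restrict_Ici, ← withDensity_indicator measurableSet_Ici]
  congr 1
  ext x
  by_cases hx : 0 ≤ x
  · rw [Set.indicator_of_mem (by simpa using hx), gammaPDF_of_nonneg hx]
    congr 1
    rw [Real.one_rpow, one_mul]; ring
  · rw [Set.indicator_of_notMem (by simpa using hx), gammaPDF_of_neg (not_le.1 hx)]

lemma expMeasure_eq_withDensity : expMeasure 1 =
    (volume.restrict (Set.Ioi 0)).withDensity (fun x => ENNReal.ofReal (Real.exp (-x))) := by
  rw [expMeasure, gammaMeasure_eq_withDensity]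
  simp

instance : IsProbabilityMeasure (expMeasure 1) := isProbabilityMeasure_expMeasure one_pos

lemma expMeasure_ae_pos : ∀ᵐ x ∂(expMeasure 1), 0 < x := by
  rw [expMeasure_eq_withDensity]
  exact withDensity_absolutelyContinuous _ _ (ae_restrict_mem measurableSet_Ioi)

lemma integrable_expMeasure_iff {E : Type*} [NormedAddCommGroup E] [NormedSpace ℝ E]
    {f : ℝ → E} : Integrable f (expMeasure 1) ↔
      IntegrableOn (fun x => Real.exp (-x) • f x) (Set.Ioi 0) := by
  rw [expMeasure_eq_withDensity, integrable_withDensity_iff_integrable_smul₀' (by fun_prop)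
    (by simp)]
  simp only [ENNReal.toReal_ofReal (Real.exp_pos _).le]
  rfl

lemma integral_expMeasure {E : Type*} [NormedAddCommGroup E] [NormedSpace ℝ E]
    (f : ℝ → E) : ∫ x, f x ∂(expMeasure 1) = ∫ x in Set.Ioi 0, Real.exp (-x) • f x := by
  rw [expMeasure_eq_withDensity, integral_withDensity_eq_integral_toReal_smul (by fun_prop)
    (by simp)]
  simp only [ENNReal.toReal_ofReal (Real.exp_pos _).le]

lemma integrable_pow_expMeasure (j : ℕ) : Integrable (fun x : ℝ => x ^ j) (expMeasure 1) := by
  rw [integrable_expMeasure_iff]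
  exact (integral_pow_mul_exp_neg j).1.congr_fun (fun x _ => by simp [mul_comm])
    measurableSet_Ioi

lemma integral_pow_expMeasure (j : ℕ) : ∫ x, x ^ j ∂(expMeasure 1) = j.factorial := by
  rw [integral_expMeasure, ← (integral_pow_mul_exp_neg j).2]
  exact integral_congr_ae (ae_of_all _ fun x => by simp [mul_comm])

/-- The derivative of the Taylor remainder of order `J + 1` is `s I` times that of order `J`, so the
bound follows inductively by comparing derivatives. -/
lemma norm_exp_mul_I_sub_sum_le (s : ℝ) (J : ℕ) {y : ℝ} (hy : 0 ≤ y) :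
    ‖Complex.exp (s * y * Complex.I) -
      ∑ i ∈ Finset.range J, (s * Complex.I) ^ i / (i.factorial : ℂ) * (y : ℂ) ^ i‖ ≤
        |s| ^ J / J.factorial * y ^ J := by
  induction J generalizing y with
  | zero =>
    have : Complex.exp (s * y * Complex.I) = Complex.exp ((s * y : ℝ) * Complex.I) := by
      push_cast; rfl
    simp [this, Complex.norm_exp_ofReal_mul_I]
  | succ J ih =>
    set f : ℝ → ℂ := fun y => Complex.exp (s * y * Complex.I) -
      ∑ i ∈ Finset.range (J + 1), (s * Complex.I) ^ i / (i.factorial : ℂ) * (y : ℂ) ^ i with hf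
    set f' : ℝ → ℂ := fun y => (s * Complex.I) * (Complex.exp (s * y * Complex.I) -
      ∑ i ∈ Finset.range J, (s * Complex.I) ^ i / (i.factorial : ℂ) * (y : ℂ) ^ i) with hf'
    have hder : ∀ x : ℝ, HasDerivAt f (f' x) x := by
      intro x
      have hid : HasDerivAt (fun y : ℝ => (y : ℂ)) 1 x := Complex.ofRealCLM.hasDerivAt
      have h1 : HasDerivAt (fun y : ℝ => Complex.exp (s * y * Complex.I))
          (Complex.exp (s * x * Complex.I) * (s * Complex.I)) x := by
        have := ((hid.const_mul (s : ℂ)).mul_const Complex.I).cexp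
        simpa using this
      have h2 : HasDerivAt (fun y : ℝ => ∑ i ∈ Finset.range (J + 1),
          (s * Complex.I) ^ i / (i.factorial : ℂ) * (y : ℂ) ^ i)
          (∑ i ∈ Finset.range (J + 1), (s * Complex.I) ^ i / (i.factorial : ℂ) *
            (i * (x : ℂ) ^ (i - 1) * 1)) x := by
        refine HasDerivAt.fun_sum fun i _ => ?_
        exact (hid.pow i).const_mul _
      refine (h1.sub h2).congr_deriv ?_
      rw [hf', Finset.sum_range_succ']
      simp only [mul_sub, Finset.mul_sum]
      congr 1
      · ring
      · simp only [Nat.cast_zero, zero_mul, mul_zero, add_zero]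
        refine Finset.sum_congr rfl fun i _ => ?_
        have : ((i.factorial : ℕ) : ℂ) ≠ 0 := by exact_mod_cast i.factorial_ne_zero
        have h3 : ((i : ℂ) + 1) ≠ 0 := by exact_mod_cast i.succ_ne_zero
        rw [Nat.factorial_succ]
        push_cast
        field_simp
        ring
    have hB : ∀ x : ℝ, HasDerivAt (fun y : ℝ => |s| ^ (J + 1) / (J + 1).factorial * y ^ (J + 1))
        (|s| * (|s| ^ J / J.factorial * x ^ J)) x := by
      intro x
      refine ((hasDerivAt_pow (J + 1) x).const_mul _).congr_deriv ?_
      rw [Nat.factorial_succ]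
      push_cast
      field_simp
      ring
    have := image_norm_le_of_norm_deriv_right_le_deriv_boundary (a := 0) (b := y)
      (f := f) (f' := f') (fun x _ => (hder x).continuousAt.continuousWithinAt)
      (fun x _ => (hder x).hasDerivWithinAt) (B := fun y : ℝ => _) (by
        simp only [hf]
        rw [Finset.sum_range_succ']
        simp) hB (fun x hx => by
        rw [hf', norm_mul]
        simp only [norm_mul, Complex.norm_real, Complex.norm_I, mul_one, Real.norm_eq_abs]
        exact mul_le_mul_of_nonneg_left (ih hx.1) (abs_nonneg s)) (x := y) ⟨hy, le_rfl⟩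
    exact this

lemma integrable_pow_mul_exp_mul_I {μ : Measure ℝ} {j : ℕ} (t : ℝ)
    (h : Integrable (fun x : ℝ => x ^ j) μ) :
    Integrable (fun x : ℝ => (x : ℂ) ^ j * Complex.exp (t * x * Complex.I)) μ := by
  refine h.norm.mono' (by fun_prop) (ae_of_all _ fun x => ?_)
  have : Complex.exp (t * x * Complex.I) = Complex.exp ((t * x : ℝ) * Complex.I) := by
    push_cast; rfl
  rw [norm_mul, this, Complex.norm_exp_ofReal_mul_I, mul_one]
  simp

/-- Taylor expansion of the characteristic function around `t`. The extra factor `x^j` lets the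
expansion be applied to all derivatives at once, which iterated translation requires. -/
lemma norm_integral_exp_sub_sum_le {μ : Measure ℝ} (h0 : ∀ᵐ x ∂μ, 0 ≤ x)
    (hint : ∀ j : ℕ, Integrable (fun x : ℝ => x ^ j) μ) (t s : ℝ) (j J : ℕ) :
    ‖∫ x, (x : ℂ) ^ j * Complex.exp ((t + s : ℝ) * x * Complex.I) ∂μ -
      ∑ i ∈ Finset.range J, (s * Complex.I) ^ i / (i.factorial : ℂ) *
        ∫ x, (x : ℂ) ^ (i + j) * Complex.exp (t * x * Complex.I) ∂μ‖ ≤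
      |s| ^ J / J.factorial * ∫ x, x ^ (J + j) ∂μ := by
  have h1 : ∑ i ∈ Finset.range J, (s * Complex.I) ^ i / (i.factorial : ℂ) *
        ∫ x, (x : ℂ) ^ (i + j) * Complex.exp (t * x * Complex.I) ∂μ =
      ∫ x, ∑ i ∈ Finset.range J, (s * Complex.I) ^ i / (i.factorial : ℂ) *
        ((x : ℂ) ^ (i + j) * Complex.exp (t * x * Complex.I)) ∂μ := by
    rw [integral_finsetSum _ fun i _ =>
      (integrable_pow_mul_exp_mul_I t (hint (i + j))).const_mul _]
    simp only [integral_const_mul]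
  rw [h1, ← integral_sub (integrable_pow_mul_exp_mul_I _ (hint j))
    (integrable_finsetSum _ fun i _ =>
      (integrable_pow_mul_exp_mul_I t (hint (i + j))).const_mul _), ← integral_const_mul]
  refine norm_integral_le_of_norm_le ((hint _).const_mul _) ?_
  filter_upwards [h0] with x hx
  have h2 : (x : ℂ) ^ j * Complex.exp ((t + s : ℝ) * x * Complex.I) -
      ∑ i ∈ Finset.range J, (s * Complex.I) ^ i / (i.factorial : ℂ) *
        ((x : ℂ) ^ (i + j) * Complex.exp (t * x * Complex.I)) =
      (x : ℂ) ^ j * Complex.exp ((t * x : ℝ) * Complex.I) *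
        (Complex.exp (s * x * Complex.I) -
          ∑ i ∈ Finset.range J, (s * Complex.I) ^ i / (i.factorial : ℂ) * (x : ℂ) ^ i) := by
    rw [mul_sub, Finset.mul_sum]
    congr 1
    · rw [mul_assoc ((x : ℂ) ^ j), ← Complex.exp_add]
      congr 2
      push_cast; ring
    · refine Finset.sum_congr rfl fun i _ => ?_
      push_cast; ring
  rw [h2, norm_mul, norm_mul, Complex.norm_exp_ofReal_mul_I, mul_one, norm_pow, Complex.norm_real,
    Real.norm_eq_abs, abs_of_nonneg hx]
  calc x ^ j * _ ≤ x ^ j * (|s| ^ J / J.factorial * x ^ J) := by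
        gcongr
        exact norm_exp_mul_I_sub_sum_le s J hx
    _ = _ := by ring

/-- The expression is `j!` times the general term of the convergent series `∑ C(J+j, j) r^J`. -/
lemma tendsto_pow_mul_factorial_div (j : ℕ) {r : ℝ} (hr0 : 0 ≤ r) (hr : r < 1) :
    Tendsto (fun J : ℕ => r ^ J / J.factorial * ((J + j).factorial : ℝ)) atTop (𝓝 0) := by
  have h := (summable_choose_mul_geometric_of_norm_lt_one j (r := r)
    (by rwa [Real.norm_of_nonneg hr0])).tendsto_atTop_zero.const_mul (j.factorial : ℝ)
  rw [mul_zero] at h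
  refine h.congr fun J => ?_
  have : ((J + j).factorial : ℝ) = (J + j).choose j * j.factorial * J.factorial := by
    rw [add_comm J j]
    have := Nat.add_choose_mul_factorial_mul_factorial j J
    rw [← this, add_comm j J, Nat.choose_symm_add]
    push_cast
    ring
  rw [this]
  field_simp

/-- Convergence of all moments to those of the unit exponential law forces convergence of the
characteristic functions. -/
lemma tendsto_integral_pow_mul_exp {μ : ℕ → Measure ℝ} {ν : Measure ℝ}
    (h0 : ∀ n, ∀ᵐ x ∂μ n, 0 ≤ x) (h0' : ∀ᵐ x ∂ν, 0 ≤ x)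
    (hint : ∀ n, ∀ j : ℕ, Integrable (fun x : ℝ => x ^ j) (μ n))
    (hint' : ∀ j : ℕ, Integrable (fun x : ℝ => x ^ j) ν)
    (hmom : ∀ j : ℕ, ∀ᶠ n in atTop, ∫ x, x ^ j ∂μ n = j.factorial)
    (hmom' : ∀ j : ℕ, ∫ x, x ^ j ∂ν = j.factorial) (t : ℝ) (j : ℕ) :
    Tendsto (fun n => ∫ x, (x : ℂ) ^ j * Complex.exp (t * x * Complex.I) ∂μ n) atTop
      (𝓝 (∫ x, (x : ℂ) ^ j * Complex.exp (t * x * Complex.I) ∂ν)) := by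
  -- With moments `j!` the Taylor remainder is controlled only for `|s| < 1`. Convergence of all
  -- derivatives at `t` therefore gives the same at `t + s`, and any frequency is reached in
  -- finitely many steps from `0`, where the claim is convergence of moments.
  have step : ∀ t s : ℝ, |s| < 1 →
      (∀ j : ℕ, Tendsto (fun n => ∫ x, (x : ℂ) ^ j * Complex.exp (t * x * Complex.I) ∂μ n) atTop
        (𝓝 (∫ x, (x : ℂ) ^ j * Complex.exp (t * x * Complex.I) ∂ν))) → ∀ j : ℕ,
      Tendsto (fun n => ∫ x, (x : ℂ) ^ j * Complex.exp ((t + s : ℝ) * x * Complex.I) ∂μ n) atTop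
        (𝓝 (∫ x, (x : ℂ) ^ j * Complex.exp ((t + s : ℝ) * x * Complex.I) ∂ν)) := by
    intro t s hs ht j
    rw [Metric.tendsto_nhds]
    intro ε hε
    obtain ⟨J, hJ⟩ := ((tendsto_pow_mul_factorial_div j (abs_nonneg s) hs).eventually
      (gt_mem_nhds (show (0 : ℝ) < ε / 3 by positivity))).exists
    have hsum : Tendsto (fun n => ∑ i ∈ Finset.range J, (s * Complex.I) ^ i / (i.factorial : ℂ) *
        ∫ x, (x : ℂ) ^ (i + j) * Complex.exp (t * x * Complex.I) ∂μ n) atTop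
        (𝓝 (∑ i ∈ Finset.range J, (s * Complex.I) ^ i / (i.factorial : ℂ) *
        ∫ x, (x : ℂ) ^ (i + j) * Complex.exp (t * x * Complex.I) ∂ν)) :=
      tendsto_finsetSum _ fun i _ => (ht (i + j)).const_mul _
    filter_upwards [hmom (J + j), (Metric.tendsto_nhds.1 hsum) (ε / 3) (by positivity)]
      with n hn1 hn2
    have e1 := norm_integral_exp_sub_sum_le (h0 n) (hint n) t s j J
    have e2 := norm_integral_exp_sub_sum_le h0' hint' t s j J
    rw [hn1] at e1
    rw [hmom'] at e2
    rw [dist_eq_norm] at hn2 ⊢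
    set A := ∫ x, (x : ℂ) ^ j * Complex.exp ((t + s : ℝ) * x * Complex.I) ∂μ n
    set B := ∫ x, (x : ℂ) ^ j * Complex.exp ((t + s : ℝ) * x * Complex.I) ∂ν
    set A' := ∑ i ∈ Finset.range J, (s * Complex.I) ^ i / (i.factorial : ℂ) *
        ∫ x, (x : ℂ) ^ (i + j) * Complex.exp (t * x * Complex.I) ∂μ n
    set B' := ∑ i ∈ Finset.range J, (s * Complex.I) ^ i / (i.factorial : ℂ) *
        ∫ x, (x : ℂ) ^ (i + j) * Complex.exp (t * x * Complex.I) ∂ν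
    calc ‖A - B‖ = ‖(A - A') + (A' - B') - (B - B')‖ := by congr 1; ring
      _ ≤ ‖A - A'‖ + ‖A' - B'‖ + ‖B - B'‖ :=
        (norm_sub_le _ _).trans (by gcongr; exact norm_add_le _ _)
      _ < ε := by linarith
  obtain ⟨N, hN⟩ := exists_nat_gt |t|
  have hNpos : (0 : ℝ) < N := (abs_nonneg t).trans_lt hN
  have hs : |t / N| < 1 := by
    rw [abs_div, Nat.abs_cast, div_lt_one hNpos]; exact hN
  have key : ∀ m : ℕ, ∀ j : ℕ,
      Tendsto (fun n => ∫ x, (x : ℂ) ^ j * Complex.exp ((m * (t / N) : ℝ) * x * Complex.I) ∂μ n)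
        atTop (𝓝 (∫ x, (x : ℂ) ^ j * Complex.exp ((m * (t / N) : ℝ) * x * Complex.I) ∂ν)) := by
    intro m
    induction m with
    | zero =>
      intro j
      have : ∀ θ : Measure ℝ, ∫ x, (x : ℂ) ^ j *
          Complex.exp (((0 : ℕ) * (t / N) : ℝ) * x * Complex.I) ∂θ = ((∫ x, x ^ j ∂θ : ℝ) : ℂ) :=
        fun θ => by rw [← integral_complex_ofReal]; simp
      simp only [this]
      refine tendsto_const_nhds.congr' ?_
      filter_upwards [hmom j] with n hn
      rw [hn, hmom']
    | succ m ih =>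
      have := step _ _ hs ih
      intro j
      have h2 := this j
      rwa [show (m : ℝ) * (t / N) + t / N = ((m + 1 : ℕ) : ℝ) * (t / N) by push_cast; ring] at h2
  have := key N j
  rwa [mul_div_cancel₀ t hNpos.ne'] at this

/-- The discrete measure of the Gauss-Laguerre rule with `n` nodes. -/
noncomputable def laguerreMeasure (n : ℕ) : Measure ℝ :=
  ∑ τ ∈ laguerreNodes n, ENNReal.ofReal (laguerreWeight n τ) • Measure.dirac τ

lemma integrable_laguerreMeasure {E : Type*} [NormedAddCommGroup E] (n : ℕ) (f : ℝ → E) :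
    Integrable f (laguerreMeasure n) := by
  rw [laguerreMeasure, integrable_finsetSum_measure]
  intro τ _
  exact (integrable_dirac (by simp)).smul_measure ENNReal.ofReal_ne_top

lemma integral_laguerreMeasure {E : Type*} [NormedAddCommGroup E] [NormedSpace ℝ E]
    [CompleteSpace E] (n : ℕ) (f : ℝ → E) :
    ∫ x, f x ∂laguerreMeasure n = ∑ τ ∈ laguerreNodes n, laguerreWeight n τ • f τ := by
  rw [laguerreMeasure, integral_finsetSum_measure fun τ _ =>
    (integrable_dirac (by simp)).smul_measure ENNReal.ofReal_ne_top]
  refine Finset.sum_congr rfl fun τ hτ => ?_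
  rw [integral_smul_measure, integral_dirac, ENNReal.toReal_ofReal (laguerreWeight_pos hτ).le]

instance (n : ℕ) : IsFiniteMeasure (laguerreMeasure n) := by
  rw [← integrable_const_iff_isFiniteMeasure (c := (1 : ℝ)) one_ne_zero]
  exact integrable_laguerreMeasure n _

/-- Total mass one is exactness in degree `0`. The shift excludes the empty rule `n = 0`, which is
the zero measure. -/
instance (n : ℕ) : IsProbabilityMeasure (laguerreMeasure (n + 1)) := by
  have h := integral_laguerreMeasure (n + 1) (fun _ => (1 : ℝ))
  have h2 := sum_laguerreWeight_mul_pow (n := n + 1) (j := 0) (by omega)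
  simp only [pow_zero, mul_one, Nat.factorial_zero, Nat.cast_one] at h2
  simp only [smul_eq_mul, mul_one, h2, integral_const] at h
  exact isProbabilityMeasure_iff_real.2 h

lemma laguerreMeasure_ae_nonneg (n : ℕ) : ∀ᵐ x ∂laguerreMeasure n, 0 ≤ x := by
  rw [laguerreMeasure, ae_iff, Measure.finsetSum_apply]
  refine Finset.sum_eq_zero fun τ hτ => ?_
  have := laguerreNodes_pos hτ
  simp [this.le]

/-- The law of the unit exponential as a probability measure. -/
noncomputable def expProb : ProbabilityMeasure ℝ := ⟨expMeasure 1, inferInstance⟩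

/-- The Gauss-Laguerre rule with `n + 1` nodes as a probability measure. -/
noncomputable def laguerreProb (n : ℕ) : ProbabilityMeasure ℝ :=
  ⟨laguerreMeasure (n + 1), inferInstance⟩

/-- The moment of order `j` is exact as soon as `j < 2(n+1)`; convergence of characteristic
functions then gives weak convergence by Lévy's theorem. -/
lemma tendsto_laguerreProb : Tendsto laguerreProb atTop (𝓝 expProb) := by
  refine ProbabilityMeasure.tendsto_of_tendsto_charFun fun t => ?_
  have := tendsto_integral_pow_mul_exp (μ := fun n => laguerreMeasure (n + 1))
    (ν := expMeasure 1) (fun n => laguerreMeasure_ae_nonneg _)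
    (expMeasure_ae_pos.mono fun x hx => hx.le) (fun n j => integrable_laguerreMeasure _ _)
    integrable_pow_expMeasure (fun j => ?_) integral_pow_expMeasure t 0
  · simp only [pow_zero, one_mul] at this
    simp only [charFun_apply_real]
    exact this
  · filter_upwards [eventually_ge_atTop j] with n hn
    rw [integral_laguerreMeasure]
    exact sum_laguerreWeight_mul_pow (by omega)

/-- The tensorized Gauss-Laguerre rule converges on bounded continuous functions. -/
theorem tendsto_sum_laguerre_mul (g : BoundedContinuousFunction (ℝ × ℝ) ℝ) :
    Tendsto (fun n : ℕ × ℕ => ∑ s ∈ laguerreNodes n.1, ∑ d ∈ laguerreNodes n.2,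
      laguerreWeight n.1 s * laguerreWeight n.2 d * g (s, d)) (atTop ×ˢ atTop)
      (𝓝 (∫ z, g z ∂(expMeasure 1).prod (expMeasure 1))) := by
  have h1 : Tendsto (fun n : ℕ × ℕ => (laguerreProb n.1).prod (laguerreProb n.2))
      (atTop ×ˢ atTop) (𝓝 (expProb.prod expProb)) :=
    (ProbabilityMeasure.continuous_prod.tendsto (expProb, expProb)).comp
      (((tendsto_laguerreProb.comp tendsto_fst).prodMk_nhds
        (tendsto_laguerreProb.comp tendsto_snd)))
  have h2 := (ProbabilityMeasure.tendsto_iff_forall_integral_tendsto.1 h1) g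
  have h3 : ∀ n : ℕ × ℕ, ∫ z, g z ∂((laguerreProb n.1).prod (laguerreProb n.2) :
      Measure (ℝ × ℝ)) = ∑ s ∈ laguerreNodes (n.1 + 1), ∑ d ∈ laguerreNodes (n.2 + 1),
      laguerreWeight (n.1 + 1) s * laguerreWeight (n.2 + 1) d * g (s, d) := by
    intro n
    have : ((laguerreProb n.1).prod (laguerreProb n.2) : Measure (ℝ × ℝ)) =
      (laguerreMeasure (n.1 + 1)).prod (laguerreMeasure (n.2 + 1)) := rfl
    rw [this, integral_prod _ (g.integrable _), integral_laguerreMeasure]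
    refine Finset.sum_congr rfl fun s _ => ?_
    rw [integral_laguerreMeasure, smul_eq_mul, Finset.mul_sum]
    exact Finset.sum_congr rfl fun d _ => by rw [smul_eq_mul, mul_assoc]
  simp only [h3] at h2
  -- Undoes the index shift of `laguerreProb`; it is harmless once both indices are at least `1`.
  have h4 : Tendsto (fun n : ℕ × ℕ => (n.1 - 1, n.2 - 1)) (atTop ×ˢ atTop)
      (atTop ×ˢ atTop : Filter (ℕ × ℕ)) :=
    (tendsto_sub_atTop_nat 1).prodMap (tendsto_sub_atTop_nat 1)
  refine (h2.comp h4).congr' ?_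
  have h5 : ∀ᶠ n : ℕ × ℕ in atTop ×ˢ atTop, 1 ≤ n.1 ∧ 1 ≤ n.2 :=
    (eventually_ge_atTop 1).prod_mk (eventually_ge_atTop 1)
  filter_upwards [h5] with n hn
  simp only [Function.comp, Nat.sub_add_cancel hn.1, Nat.sub_add_cancel hn.2]

end Quadrature

/-! ### The law and the mean of the cascaded gain. -/

section ChannelLaw

lemma integral_gammaMeasure {E : Type*} [NormedAddCommGroup E] [NormedSpace ℝ E] {a : ℝ}
    (ha : 0 < a) (f : ℝ → E) : ∫ x, f x ∂(gammaMeasure a 1) =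
      ∫ x in Set.Ioi 0, (x ^ (a - 1) * Real.exp (-x) / Real.Gamma a) • f x := by
  rw [gammaMeasure_eq_withDensity, integral_withDensity_eq_integral_toReal_smul (by fun_prop)
    (by simp)]
  refine setIntegral_congr_fun measurableSet_Ioi fun x hx => ?_
  have hx' : (0 : ℝ) < x := hx
  have := Real.Gamma_pos_of_pos ha
  rw [ENNReal.toReal_ofReal (by positivity)]

lemma integrableOn_pow_mul_cexp_neg (t : ℝ) (n : ℕ) : IntegrableOn
    (fun x : ℝ => (x : ℂ) ^ n * Complex.exp (-((1 - t * Complex.I) * x))) (Set.Ioi 0) := by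
  refine (integral_pow_mul_exp_neg n).1.mono' (by fun_prop)
    ((ae_restrict_mem measurableSet_Ioi).mono fun x hx => ?_)
  have hx' : (0 : ℝ) < x := hx
  rw [norm_mul, Complex.norm_exp]
  simp [abs_of_pos hx']

/-- Induction on `n` by integrating by parts; `Re (1 - t I) = 1` makes the boundary terms at
infinity vanish. -/
lemma integral_pow_mul_cexp_neg (t : ℝ) (n : ℕ) :
    ∫ x in Set.Ioi (0 : ℝ), (x : ℂ) ^ n * Complex.exp (-((1 - t * Complex.I) * x)) =
      n.factorial * (1 / (1 - t * Complex.I)) ^ (n + 1) := by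
  set r : ℂ := 1 - t * Complex.I with hr
  have hr0 : r ≠ 0 := fun h => by
    have := congr_arg Complex.re h
    simp [hr] at this
  have hid : ∀ x : ℝ, HasDerivAt (fun y : ℝ => (y : ℂ)) 1 x := fun x =>
    Complex.ofRealCLM.hasDerivAt
  have hexp : ∀ x : ℝ, HasDerivAt (fun y : ℝ => Complex.exp (-(r * y)))
      (-r * Complex.exp (-(r * x))) x := fun x => by
    have := ((hid x).const_mul (-r)).cexp
    simp only [neg_mul] at this
    refine this.congr_deriv ?_
    ring
  have hlim : ∀ m : ℕ, Tendsto (fun x : ℝ => (x : ℂ) ^ m * Complex.exp (-(r * x))) atTop (𝓝 0) := by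
    intro m
    rw [tendsto_zero_iff_norm_tendsto_zero]
    refine (Real.tendsto_pow_mul_exp_neg_atTop_nhds_zero m).congr' ?_
    filter_upwards [eventually_gt_atTop 0] with x hx
    rw [norm_mul, Complex.norm_exp]
    simp [abs_of_pos hx, hr]
  have hint : ∀ m : ℕ, IntegrableOn
      (fun x : ℝ => (x : ℂ) ^ m * Complex.exp (-(r * x))) (Set.Ioi 0) :=
    integrableOn_pow_mul_cexp_neg t
  induction n with
  | zero =>
    have h := integral_Ioi_of_hasDerivAt_of_tendsto (a := 0)
      (f := fun x : ℝ => (x : ℂ) ^ 0 * Complex.exp (-(r * x)))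
      (f' := fun x : ℝ => -r * ((x : ℂ) ^ 0 * Complex.exp (-(r * x))))
      (by fun_prop) (fun x _ => by simpa using hexp x)
      ((hint 0).const_mul (-r)) (hlim 0)
    rw [integral_const_mul] at h
    rw [← mul_right_inj' (neg_ne_zero.2 hr0), h]
    simp
    field_simp
  | succ n ih =>
    have h := integral_Ioi_of_hasDerivAt_of_tendsto (a := 0)
      (f := fun x : ℝ => (x : ℂ) ^ (n + 1) * Complex.exp (-(r * x)))
      (f' := fun x : ℝ => (n + 1) * ((x : ℂ) ^ n * Complex.exp (-(r * x))) +
        -r * ((x : ℂ) ^ (n + 1) * Complex.exp (-(r * x))))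
      (by fun_prop) (fun x _ => by
        refine (((hid x).pow (n + 1)).mul (hexp x)).congr_deriv ?_
        simp only [Pi.pow_apply]
        push_cast
        ring)
      (((hint n).const_mul _).add ((hint (n + 1)).const_mul (-r))) (hlim (n + 1))
    rw [integral_add ((hint n).const_mul _) ((hint (n + 1)).const_mul (-r)),
      integral_const_mul, integral_const_mul, ih] at h
    rw [← mul_right_inj' (neg_ne_zero.2 hr0), ← sub_eq_zero]
    simp only [Complex.ofReal_zero, ne_eq, Nat.succ_ne_zero, not_false_eq_true, zero_pow, zero_mul,
      sub_zero] at h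
    rw [← h, Nat.factorial_succ]
    push_cast
    have hrr : r * (1 / r) = 1 := mul_one_div_cancel hr0
    rw [pow_succ (1 / r) (n + 1)]
    linear_combination ((n + 1) * n.factorial * (1 / r) ^ (n + 1) : ℂ) * hrr

lemma charFun_gammaMeasure {Q : ℕ} (hQ : 1 ≤ Q) (t : ℝ) :
    charFun (gammaMeasure Q 1) t = (1 / (1 - t * Complex.I)) ^ Q := by
  obtain ⟨n, rfl⟩ := Nat.exists_eq_add_of_le' hQ
  have hn : (n.factorial : ℂ) ≠ 0 := by exact_mod_cast n.factorial_ne_zero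
  rw [charFun_apply_real, integral_gammaMeasure (by positivity),
    ← mul_div_cancel_left₀ ((1 / (1 - t * Complex.I)) ^ (n + 1)) hn, ← integral_pow_mul_cexp_neg,
    ← integral_div]
  refine setIntegral_congr_fun measurableSet_Ioi fun x hx => ?_
  have hx' : (0 : ℝ) < x := hx
  have h2 : -((1 - t * Complex.I) * x) = ((-x : ℝ) : ℂ) + t * x * Complex.I := by
    push_cast; ring
  have h3 : Real.Gamma ((n + 1 : ℕ) : ℝ) = n.factorial := by
    push_cast; exact Real.Gamma_nat_eq_factorial n
  have h4 : x ^ (((n + 1 : ℕ) : ℝ) - 1) = x ^ n := by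
    push_cast; rw [add_sub_cancel_right, Real.rpow_natCast]
  rw [h2, h3, h4, Complex.exp_add, Complex.real_smul, ← Complex.ofReal_exp]
  push_cast
  ring

lemma charFun_expMeasure (t : ℝ) : charFun (expMeasure 1) t = 1 / (1 - t * Complex.I) := by
  have := charFun_gammaMeasure (Q := 1) le_rfl t
  simpa [expMeasure] using this

instance (N : ℝ) : IsProbabilityMeasure (complexGaussian N) := by
  unfold complexGaussian
  refine Measure.isProbabilityMeasure_map ?_
  exact (by fun_prop : Measurable fun z : ℝ × ℝ => (Complex.measurableEquivRealProd.symm z)).aemeasurable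

lemma measurable_mk_complex : Measurable fun z : ℝ × ℝ => (⟨z.1, z.2⟩ : ℂ) :=
  Complex.measurableEquivRealProd.symm.measurable

lemma charFun_complexGaussian {N : ℝ} (hN : 0 ≤ N) (t : ℂ) :
    charFun (complexGaussian N) t = Complex.exp (-(N * ‖t‖ ^ 2 / 4)) := by
  rw [charFun_apply, complexGaussian, integral_map measurable_mk_complex.aemeasurable
    (by fun_prop)]
  have h1 : ∀ z : ℝ × ℝ, Complex.exp ((inner ℝ (⟨z.1, z.2⟩ : ℂ) t : ℝ) * Complex.I) =
      Complex.exp (t.re * z.1 * Complex.I) * Complex.exp (t.im * z.2 * Complex.I) := by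
    intro z
    rw [← Complex.exp_add, Complex.inner]
    congr 1
    simp
    ring
  simp only [h1]
  rw [integral_prod_mul (fun x : ℝ => Complex.exp (t.re * x * Complex.I))
    (fun x : ℝ => Complex.exp (t.im * x * Complex.I)), ← charFun_apply_real, ← charFun_apply_real,
    charFun_gaussianReal, charFun_gaussianReal, ← Complex.exp_add]
  congr 1
  have h2 : (((N / 2).toNNReal : ℝ) : ℂ) = (N : ℂ) / 2 := by
    rw [Real.coe_toNNReal _ (by positivity)]; push_cast; rfl
  have h3 : ((‖t‖ : ℝ) : ℂ) ^ 2 = (t.re : ℂ) ^ 2 + (t.im : ℂ) ^ 2 := by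
    rw [← Complex.ofReal_pow, Complex.sq_norm, Complex.normSq_apply]; push_cast; ring
  rw [h2, h3]
  simp
  ring

/-- A linear combination of independent complex Gaussians is complex Gaussian. -/
lemma map_sum_mul_pi_complexGaussian {ι : Type*} [Fintype ι] {N : ℝ} (hN : 0 ≤ N) (c : ι → ℂ) :
    (Measure.pi fun _ : ι => complexGaussian N).map (fun h => ∑ i, c i * h i) =
      complexGaussian (N * ∑ i, ‖c i‖ ^ 2) := by
  have hm : Measurable fun h : ι → ℂ => ∑ i, c i * h i := by fun_prop
  have := Measure.isProbabilityMeasure_map (μ := Measure.pi fun _ : ι => complexGaussian N)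
    hm.aemeasurable
  refine Measure.ext_of_charFun (funext fun t => ?_)
  rw [charFun_complexGaussian (mul_nonneg hN (Finset.sum_nonneg fun i _ => by positivity)),
    charFun_apply, integral_map hm.aemeasurable (by fun_prop)]
  have h1 : ∀ h : ι → ℂ, Complex.exp ((inner ℝ (∑ i, c i * h i) t : ℝ) * Complex.I) =
      ∏ i, Complex.exp ((inner ℝ (h i) (star (c i) * t) : ℝ) * Complex.I) := by
    intro h
    rw [← Complex.exp_sum, sum_inner, Complex.ofReal_sum, Finset.sum_mul]
    congr 1
    refine Finset.sum_congr rfl fun i _ => ?_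
    rw [Complex.inner, Complex.inner]
    congr 3
    simp only [map_mul, Complex.star_def]
    ring
  simp only [h1]
  rw [integral_fintype_prod_eq_prod (fun i (z : ℂ) =>
    Complex.exp ((inner ℝ z (star (c i) * t) : ℝ) * Complex.I))]
  simp only [← charFun_apply, charFun_complexGaussian hN]
  rw [← Complex.exp_sum]
  congr 1
  simp only [norm_mul, norm_star]
  push_cast
  rw [Finset.mul_sum, Finset.sum_mul, Finset.sum_div, ← Finset.sum_neg_distrib]
  exact Finset.sum_congr rfl fun i _ => by ring

/-- The square corresponds to the two independent parts in `|z|² = x² + y²`, and it removes the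
complex square root from the Gaussian integral. -/
lemma integral_exp_mul_sq_gaussianReal {N : ℝ} (hN : 0 < N) (t : ℝ) :
    (∫ x, Complex.exp (t * (x ^ 2 : ℝ) * Complex.I) ∂gaussianReal 0 (N / 2).toNNReal) ^ 2 =
      1 / (1 - (t * N : ℝ) * Complex.I) := by
  have hN2 : (N / 2).toNNReal ≠ 0 := by simpa using hN
  have hv : (((N / 2).toNNReal : NNReal) : ℝ) = N / 2 := Real.coe_toNNReal _ (by positivity)
  rw [integral_gaussianReal_eq_integral_smul hN2]
  have hb : 0 < (1 / N - t * Complex.I : ℂ).re := by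
    rw [← Complex.ofReal_one, ← Complex.ofReal_div]; simpa using hN
  have h1 : ∀ x : ℝ, gaussianPDFReal 0 (N / 2).toNNReal x •
      Complex.exp (t * (x ^ 2 : ℝ) * Complex.I) =
      ((√(Real.pi * N))⁻¹ : ℝ) * Complex.exp (-(1 / N - t * Complex.I) * x ^ 2) := by
    intro x
    rw [gaussianPDFReal, hv, Complex.real_smul, Complex.ofReal_mul, Complex.ofReal_exp, mul_assoc,
      ← Complex.exp_add]
    congr 2
    · rw [show 2 * Real.pi * (N / 2) = Real.pi * N by ring]
    · push_cast; field_simp; ring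
  simp only [h1]
  rw [integral_const_mul, integral_gaussian_complex hb, mul_pow, ← Complex.ofReal_pow, inv_pow,
    Real.sq_sqrt (by positivity), ← Complex.cpow_nat_mul]
  have hne : (1 / N - t * Complex.I : ℂ) ≠ 0 := fun h => by rw [h] at hb; simp at hb
  have hN' : (N : ℂ) ≠ 0 := by exact_mod_cast hN.ne'
  have hpi : (Real.pi : ℂ) ≠ 0 := by exact_mod_cast Real.pi_ne_zero
  have hne2 : (1 - t * N * Complex.I : ℂ) ≠ 0 := by
    have : (1 - t * N * Complex.I : ℂ) = N * (1 / N - t * Complex.I) := by field_simp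
    rw [this]; exact mul_ne_zero hN' hne
  push_cast
  rw [show (2 : ℂ) * (1 / 2) = 1 by norm_num, Complex.cpow_one, eq_div_iff hne2]
  have : (1 - t * N * Complex.I : ℂ) = N * (1 / N - t * Complex.I) := by field_simp
  rw [this]
  set b : ℂ := 1 / N - t * Complex.I
  field_simp

lemma integral_exp_mul_norm_sq_complexGaussian {N : ℝ} (hN : 0 < N) (t : ℝ) :
    ∫ z, Complex.exp (t * (‖z‖ ^ 2 : ℝ) * Complex.I) ∂complexGaussian N =
      1 / (1 - (t * N : ℝ) * Complex.I) := by
  rw [complexGaussian, integral_map measurable_mk_complex.aemeasurable (by fun_prop),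
    ← integral_exp_mul_sq_gaussianReal hN, sq, ← integral_prod_mul]
  refine integral_congr_ae (ae_of_all _ fun z => ?_)
  simp only
  rw [← Complex.exp_add, Complex.sq_norm, Complex.normSq_apply]
  congr 1
  push_cast
  ring

/-- The squared modulus of a complex Gaussian is exponential. -/
lemma map_norm_sq_complexGaussian {N : ℝ} (hN : 0 ≤ N) :
    (complexGaussian N).map (fun z => ‖z‖ ^ 2) = (expMeasure 1).map (fun x => N * x) := by
  have h1 : Measurable fun z : ℂ => ‖z‖ ^ 2 := by fun_prop
  have h2 : Measurable fun x : ℝ => N * x := by fun_prop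
  have := Measure.isProbabilityMeasure_map (μ := complexGaussian N) h1.aemeasurable
  have := Measure.isProbabilityMeasure_map (μ := expMeasure 1) h2.aemeasurable
  -- The degenerate case `N = 0` is needed because the conditional variance of the channel vanishes
  -- when `h_r` is zero on the active block.
  rcases hN.eq_or_lt with rfl | hN
  · have hd : complexGaussian 0 = Measure.dirac 0 := by
      have : (Measure.dirac ((0 : ℝ), (0 : ℝ))).map (fun z : ℝ × ℝ => (⟨z.1, z.2⟩ : ℂ)) =
          Measure.dirac 0 := by
        rw [Measure.map_dirac' measurable_mk_complex]; rfl
      simpa [complexGaussian, Measure.dirac_prod_dirac] using this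
    rw [hd, Measure.map_dirac' h1]
    simp
  · refine Measure.ext_of_charFun (funext fun t => ?_)
    rw [charFun_map_mul, charFun_expMeasure, charFun_apply_real,
      integral_map h1.aemeasurable (by fun_prop),
      integral_exp_mul_norm_sq_complexGaussian hN, mul_comm N t]

/-- The sum of squared moduli of part of a family of independent complex Gaussians has a Gamma
law. -/
lemma map_sum_norm_sq_pi_complexGaussian {ι : Type*} [Fintype ι] (s : Finset ι)
    (hs : s.Nonempty) {N : ℝ} (hN : 0 < N) :
    (Measure.pi fun _ : ι => complexGaussian N).map (fun h => ∑ i ∈ s, ‖h i‖ ^ 2) =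
      (gammaMeasure s.card 1).map (fun x => N * x) := by
  classical
  have h1 : Measurable fun h : ι → ℂ => ∑ i ∈ s, ‖h i‖ ^ 2 := by fun_prop
  have h2 : Measurable fun x : ℝ => N * x := by fun_prop
  have := Measure.isProbabilityMeasure_map (μ := Measure.pi fun _ : ι => complexGaussian N)
    h1.aemeasurable
  have := isProbabilityMeasure_gammaMeasure (a := s.card) (r := 1)
    (by exact_mod_cast hs.card_pos) one_pos
  have := Measure.isProbabilityMeasure_map (μ := gammaMeasure s.card 1) h2.aemeasurable
  refine Measure.ext_of_charFun (funext fun t => ?_)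
  rw [charFun_map_mul, charFun_gammaMeasure hs.card_pos, charFun_apply_real,
    integral_map h1.aemeasurable (by fun_prop)]
  have h3 : ∀ h : ι → ℂ, Complex.exp (t * (∑ i ∈ s, ‖h i‖ ^ 2 : ℝ) * Complex.I) =
      ∏ i, if i ∈ s then Complex.exp (t * (‖h i‖ ^ 2 : ℝ) * Complex.I) else 1 := by
    intro h
    rw [Finset.prod_ite_mem, Finset.univ_inter, ← Complex.exp_sum, Complex.ofReal_sum,
      Finset.mul_sum, Finset.sum_mul]
  simp only [h3]
  rw [integral_fintype_prod_eq_prod (fun i (z : ℂ) =>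
    if i ∈ s then Complex.exp (t * (‖z‖ ^ 2 : ℝ) * Complex.I) else 1)]
  have h4 : ∀ i, ∫ z, (if i ∈ s then Complex.exp (t * (‖z‖ ^ 2 : ℝ) * Complex.I) else 1)
      ∂complexGaussian N = if i ∈ s then 1 / (1 - (t * N : ℝ) * Complex.I) else 1 := by
    intro i
    split_ifs
    · exact integral_exp_mul_norm_sq_complexGaussian hN t
    · simp
  simp only [h4]
  rw [Finset.prod_ite_mem, Finset.univ_inter, Finset.prod_const, mul_comm N t]

lemma cascadedGain_eq {P Q : ℕ} (p : Fin P) (hbr hr : ChannelVec P Q) :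
    cascadedGain p (hbr, hr) =
      ‖∑ m : Fin P × Fin Q, (if m.1 = p then star (hr m) else 0) * hbr m‖ ^ 2 := by
  rw [cascadedGain, cascadedChannel, dotProduct]
  congr 2
  refine Finset.sum_congr rfl fun m _ => ?_
  rw [Matrix.mulVec_diagonal, Pi.star_apply, Pi.star_apply]
  by_cases h : m.1 = p <;> simp [onOffMatrix, Matrix.one_apply, h]

lemma measurable_cascadedGain {P Q : ℕ} (p : Fin P) :
    Measurable (cascadedGain (Q := Q) p) := by
  have : cascadedGain (Q := Q) p = fun h : ChannelVec P Q × ChannelVec P Q =>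
      ‖∑ m : Fin P × Fin Q, (if m.1 = p then star (h.2 m) else 0) * h.1 m‖ ^ 2 :=
    funext fun h => cascadedGain_eq p h.1 h.2
  rw [this]
  refine Measurable.pow_const (Measurable.norm (Finset.measurable_sum _ fun m _ => ?_)) 2
  split_ifs
  · fun_prop
  · fun_prop

instance (P Q : ℕ) (Nbr Nr : ℝ) : IsProbabilityMeasure (channelLaw P Q Nbr Nr) := by
  unfold channelLaw; infer_instance

/-- The cascaded gain is, up to scale, a product of independent Gamma and exponential variables. -/
theorem map_cascadedGain_channelLaw {P Q : ℕ} (hQ : 1 ≤ Q) (p : Fin P) {Nbr Nr : ℝ}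
    (hbr : 0 < Nbr) (hr : 0 < Nr) :
    (channelLaw P Q Nbr Nr).map (cascadedGain p) =
      ((gammaMeasure Q 1).prod (expMeasure 1)).map (fun z => Nbr * Nr * (z.1 * z.2)) := by
  have hQ0 : (0 : ℝ) < Q := by exact_mod_cast hQ
  have := isProbabilityMeasure_gammaMeasure hQ0 one_pos
  set s : Finset (Fin P × Fin Q) := {p} ×ˢ Finset.univ with hs
  have hcard : s.card = Q := by simp [hs]
  have hsne : s.Nonempty := Finset.card_pos.1 (by omega)
  have hsum := map_sum_norm_sq_pi_complexGaussian s hsne hr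
  rw [hcard] at hsum
  refine Measure.ext_of_lintegral _ fun f hf => ?_
  rw [lintegral_map hf (measurable_cascadedGain p), lintegral_map hf (by fun_prop), channelLaw,
    lintegral_prod_symm' (fun a => f (cascadedGain p a)) (hf.comp (measurable_cascadedGain p)),
    lintegral_prod _ (by fun_prop)]
  -- With `h_r = y` fixed, the channel is a linear combination of the Gaussian entries of `h_br`.
  -- Its squared modulus is exponential with mean `Nbr` times the energy of `y` on the block; that
  -- energy is `Nr` times a Gamma variable.
  have h1 : ∀ y : ChannelVec P Q, ∫⁻ x, f (cascadedGain p (x, y))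
      ∂(Measure.pi fun _ => complexGaussian Nbr) =
      ∫⁻ e, f (Nbr * (∑ m ∈ s, ‖y m‖ ^ 2) * e) ∂expMeasure 1 := by
    intro y
    simp only [cascadedGain_eq]
    set c : Fin P × Fin Q → ℂ := fun m => if m.1 = p then star (y m) else 0 with hc
    have hc2 : ∑ m, ‖c m‖ ^ 2 = ∑ m ∈ s, ‖y m‖ ^ 2 := by
      rw [← Finset.sum_subset (Finset.subset_univ s)]
      · refine Finset.sum_congr rfl fun m hm => ?_
        have : m.1 = p := (Finset.mem_product.1 hm).1 |> Finset.mem_singleton.1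
        simp [hc, this]
      · intro m _ hm
        have : m.1 ≠ p := fun h => hm (Finset.mem_product.2 ⟨Finset.mem_singleton.2 h, Finset.mem_univ _⟩)
        simp [hc, this]
    have h2 : Measurable fun h : Fin P × Fin Q → ℂ => ∑ i, c i * h i := by fun_prop
    have h3 : Measurable fun z : ℂ => ‖z‖ ^ 2 := by fun_prop
    have h0 : 0 ≤ Nbr * ∑ m, ‖c m‖ ^ 2 :=
      mul_nonneg hbr.le (Finset.sum_nonneg fun _ _ => by positivity)
    rw [← lintegral_map (f := fun z : ℂ => f (‖z‖ ^ 2)) (hf.comp h3) h2,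
      map_sum_mul_pi_complexGaussian hbr.le]
    rw [← lintegral_map hf h3, map_norm_sq_complexGaussian h0, lintegral_map hf (by fun_prop), hc2]
  simp only [h1]
  have hg : Measurable fun x : ℝ => ∫⁻ e, f (Nbr * x * e) ∂expMeasure 1 :=
    Measurable.lintegral_prod_right' (f := fun z : ℝ × ℝ => f (Nbr * z.1 * z.2)) (by fun_prop)
  rw [← lintegral_map hg (by fun_prop : Measurable fun y : Fin P × Fin Q → ℂ =>
    ∑ m ∈ s, ‖y m‖ ^ 2), hsum, lintegral_map hg (by fun_prop)]
  simp only [mul_assoc]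

lemma integral_id_gammaMeasure {a : ℝ} (ha : 0 < a) : ∫ x, x ∂(gammaMeasure a 1) = a := by
  rw [integral_gammaMeasure ha]
  have hG := (Real.Gamma_pos_of_pos ha).ne'
  have h := Real.Gamma_eq_integral (s := a + 1) (by positivity)
  rw [Real.Gamma_add_one ha.ne'] at h
  calc ∫ x in Set.Ioi (0 : ℝ), (x ^ (a - 1) * Real.exp (-x) / Real.Gamma a) • x
      = ∫ x in Set.Ioi (0 : ℝ), (Real.exp (-x) * x ^ (a + 1 - 1)) / Real.Gamma a := by
        refine setIntegral_congr_fun measurableSet_Ioi fun x hx => ?_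
        have hx' : (0 : ℝ) < x := hx
        have : x ^ (a + 1 - 1) = x ^ (a - 1) * x := by
          rw [← Real.rpow_add_one hx'.ne']; congr 1; ring
        simp only [this, smul_eq_mul]; ring
    _ = a := by rw [integral_div, ← h]; field_simp

lemma integral_id_expMeasure : ∫ x, x ∂(expMeasure 1) = 1 := integral_id_gammaMeasure one_pos

/-- By independence the mean is `Nbr Nr` times the Gamma mean `Q` times the exponential mean `1`.
This is the source of `Q Nbr Nr1` in `ϑ` and `ς`. -/
lemma integral_cascadedGain {P Q : ℕ} (hQ : 1 ≤ Q) (p : Fin P) {Nbr Nr : ℝ}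
    (hbr : 0 < Nbr) (hr : 0 < Nr) :
    ∫ h, cascadedGain p h ∂(channelLaw P Q Nbr Nr) = Q * Nbr * Nr := by
  have hQ0 : (0 : ℝ) < Q := by exact_mod_cast hQ
  have := isProbabilityMeasure_gammaMeasure hQ0 one_pos
  have h := integral_map (μ := channelLaw P Q Nbr Nr) (f := fun x : ℝ => x)
    (measurable_cascadedGain p).aemeasurable (by fun_prop)
  rw [← h, map_cascadedGain_channelLaw hQ p hbr hr, integral_map (by fun_prop) (by fun_prop),
    integral_const_mul, integral_prod_mul (fun x : ℝ => x) (fun x : ℝ => x),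
    integral_id_gammaMeasure hQ0, integral_id_expMeasure]
  ring

end ChannelLaw

/-! ### The distribution function of the gain and its Bessel form. -/

section GainCdf

lemma gammaMeasure_ae_pos (a : ℝ) : ∀ᵐ x ∂(gammaMeasure a 1), 0 < x := by
  rw [gammaMeasure_eq_withDensity]
  exact withDensity_absolutelyContinuous _ _ (ae_restrict_mem measurableSet_Ioi)

/-- The distribution function of the product of independent Gamma (shape `Q`) and exponential
variables. -/
noncomputable def gainCdf (Q : ℕ) (z : ℝ) : ℝ :=
  ∫ g, (1 - Real.exp (-(max z 0 / g))) ∂gammaMeasure Q 1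

lemma one_sub_exp_neg_mem {x : ℝ} (hx : 0 ≤ x) : 0 ≤ 1 - Real.exp (-x) ∧ 1 - Real.exp (-x) ≤ 1 :=
  ⟨by simpa using hx, by linarith [Real.exp_pos (-x)]⟩

lemma gainCdf_integrand_bound (Q : ℕ) (z : ℝ) : ∀ᵐ g ∂gammaMeasure Q 1,
    ‖1 - Real.exp (-(max z 0 / g))‖ ≤ 1 := by
  filter_upwards [gammaMeasure_ae_pos Q] with g hg
  have := one_sub_exp_neg_mem (x := max z 0 / g) (by positivity)
  rw [Real.norm_of_nonneg this.1]
  exact this.2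

lemma isProbabilityMeasure_gammaMeasure_natCast {Q : ℕ} (hQ : 1 ≤ Q) :
    IsProbabilityMeasure (gammaMeasure Q 1) :=
  isProbabilityMeasure_gammaMeasure (by exact_mod_cast hQ) one_pos

lemma gainCdf_integrable {Q : ℕ} (hQ : 1 ≤ Q) (z : ℝ) :
    Integrable (fun g => 1 - Real.exp (-(max z 0 / g))) (gammaMeasure Q 1) := by
  have := isProbabilityMeasure_gammaMeasure_natCast hQ
  exact (integrable_const (1 : ℝ)).mono' (by fun_prop) (gainCdf_integrand_bound Q z)

lemma gainCdf_nonneg (Q : ℕ) (z : ℝ) : 0 ≤ gainCdf Q z := by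
  refine integral_nonneg_of_ae ?_
  filter_upwards [gammaMeasure_ae_pos Q] with g hg
  exact (one_sub_exp_neg_mem (x := max z 0 / g) (by positivity)).1

lemma gainCdf_le_one {Q : ℕ} (hQ : 1 ≤ Q) (z : ℝ) : gainCdf Q z ≤ 1 := by
  have := isProbabilityMeasure_gammaMeasure_natCast hQ
  have h := norm_integral_le_of_norm_le_const (gainCdf_integrand_bound Q z)
  rw [probReal_univ, mul_one] at h
  exact (le_abs_self _).trans h

lemma gainCdf_of_nonpos (Q : ℕ) {z : ℝ} (hz : z ≤ 0) : gainCdf Q z = 0 := by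
  simp [gainCdf, max_eq_right hz]

lemma gainCdf_pos {Q : ℕ} (hQ : 1 ≤ Q) {z : ℝ} (hz : 0 < z) : 0 < gainCdf Q z := by
  have := isProbabilityMeasure_gammaMeasure_natCast hQ
  refine (gainCdf_nonneg Q z).lt_of_ne fun h => ?_
  have h2 := (integral_eq_zero_iff_of_nonneg_ae (μ := gammaMeasure Q 1) (by
    filter_upwards [gammaMeasure_ae_pos Q] with g hg
    exact (one_sub_exp_neg_mem (x := max z 0 / g) (by positivity)).1)
    (gainCdf_integrable hQ z)).1 h.symm
  obtain ⟨g, hg1, hg2⟩ := (h2.and (gammaMeasure_ae_pos Q)).exists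
  rw [max_eq_left hz.le] at hg1
  have : Real.exp (-(z / g)) < 1 := by
    rw [Real.exp_lt_one_iff]; have := div_pos hz hg2; linarith
  simp only [Pi.zero_apply] at hg1
  linarith

lemma continuous_gainCdf {Q : ℕ} (hQ : 1 ≤ Q) : Continuous (gainCdf Q) := by
  have := isProbabilityMeasure_gammaMeasure_natCast hQ
  refine continuous_of_dominated (bound := fun _ => (1 : ℝ)) (fun z => by fun_prop)
    (gainCdf_integrand_bound Q) (integrable_const _) (ae_of_all _ fun g => ?_)
  fun_prop

lemma expMeasure_real_Iio {x : ℝ} (hx : 0 ≤ x) :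
    (expMeasure 1).real (Set.Iio x) = 1 - Real.exp (-x) := by
  have : NullSingletonClass (expMeasure 1) := by
    rw [expMeasure_eq_withDensity]; infer_instance
  have h := cdf_expMeasure_eq one_pos x
  rw [cdf_eq_real, if_pos hx, one_mul] at h
  rw [← h]
  exact measureReal_congr Iio_ae_eq_Iic

/-- Condition on the Gamma factor `g`: the exponential factor must lie below `x/(Nbr Nr g)`. For
negative `x` both sides vanish, which is why `gainCdf` truncates its argument at `0`. -/
lemma channelLaw_real_cascadedGain_lt {P Q : ℕ} (hQ : 1 ≤ Q) (p : Fin P) {Nbr Nr : ℝ}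
    (hbr : 0 < Nbr) (hr : 0 < Nr) (x : ℝ) :
    (channelLaw P Q Nbr Nr).real {h | cascadedGain p h < x} = gainCdf Q (x / (Nbr * Nr)) := by
  have := isProbabilityMeasure_gammaMeasure_natCast hQ
  have hN : 0 < Nbr * Nr := mul_pos hbr hr
  have h1 : (channelLaw P Q Nbr Nr).real {h | cascadedGain p h < x} =
      ((channelLaw P Q Nbr Nr).map (cascadedGain p)).real (Set.Iio x) := by
    rw [map_measureReal_apply (measurable_cascadedGain p) measurableSet_Iio]; rfl
  have hm : Measurable fun z : ℝ × ℝ => Nbr * Nr * (z.1 * z.2) := by fun_prop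
  rw [h1, map_cascadedGain_channelLaw hQ p hbr hr, map_measureReal_apply hm measurableSet_Iio,
    measureReal_def, Measure.prod_apply (hm measurableSet_Iio), gainCdf,
    ← integral_toReal (measurable_measure_prodMk_left (hm measurableSet_Iio)).aemeasurable
      (ae_of_all _ fun _ => measure_lt_top _ _)]
  refine integral_congr_ae ?_
  filter_upwards [gammaMeasure_ae_pos Q] with g hg
  have h2 : Prod.mk g ⁻¹' ((fun z : ℝ × ℝ => Nbr * Nr * (z.1 * z.2)) ⁻¹' Set.Iio x) =
      Set.Iio (x / (Nbr * Nr) / g) := by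
    ext e
    simp only [Set.mem_preimage, Set.mem_Iio]
    rw [lt_div_iff₀ hg, lt_div_iff₀ hN]
    constructor <;> intro h <;> linarith
  rw [h2, ← measureReal_def]
  rcases le_or_gt 0 (x / (Nbr * Nr)) with h | h
  · rw [expMeasure_real_Iio (div_nonneg h hg.le), max_eq_left h]
  · rw [max_eq_right h.le]
    have h3 : x / (Nbr * Nr) / g ≤ 0 := (div_neg_of_neg_of_pos h hg).le
    have h4 := measureReal_mono (μ := expMeasure 1) (Set.Iio_subset_Iio h3)
    rw [expMeasure_real_Iio le_rfl] at h4
    simp only [neg_zero, Real.exp_zero, sub_self] at h4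
    simp [le_antisymm h4 measureReal_nonneg]

lemma integrableOn_rpow_mul_exp_neg_sub_div {ν z : ℝ} (hν : 0 < ν) (hz : 0 ≤ z) :
    IntegrableOn (fun g : ℝ => g ^ (ν - 1) * Real.exp (-g - z / g)) (Set.Ioi 0) := by
  refine (Real.GammaIntegral_convergent hν).mono' (by fun_prop)
    ((ae_restrict_mem measurableSet_Ioi).mono fun g hg => ?_)
  have hg' : (0 : ℝ) < g := hg
  rw [Real.norm_of_nonneg (by positivity), mul_comm]
  gcongr
  have : 0 ≤ z / g := by positivity
  linarith

lemma image_mul_exp_univ {c : ℝ} (hc : 0 < c) :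
    (fun t => c * Real.exp t) '' Set.univ = Set.Ioi 0 := by
  ext x
  simp only [Set.image_univ, Set.mem_range, Set.mem_Ioi]
  constructor
  · rintro ⟨t, rfl⟩; positivity
  · intro hx
    exact ⟨Real.log (x / c), by rw [Real.exp_log (by positivity)]; field_simp⟩

/-- The integral representation of the modified Bessel function obtained from that by hyperbolic
functions by substitution. -/
lemma integral_rpow_mul_exp_neg_sub_div {ν z : ℝ} (hν : 0 < ν) (hz : 0 < z) :
    ∫ g in Set.Ioi (0 : ℝ), g ^ (ν - 1) * Real.exp (-g - z / g) =
      2 * z ^ (ν / 2) * besselK ν (2 * √z) := by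
  have hc : 0 < √z := Real.sqrt_pos.2 hz
  have hcc : √z * √z = z := Real.mul_self_sqrt hz.le
  have hder : ∀ t ∈ (Set.univ : Set ℝ),
      HasDerivWithinAt (fun t => √z * Real.exp t) (√z * Real.exp t) Set.univ t := fun t _ =>
    ((Real.hasDerivAt_exp t).const_mul _).hasDerivWithinAt
  have hinj : Set.InjOn (fun t => √z * Real.exp t) Set.univ := fun a _ b _ h =>
    Real.exp_injective (mul_left_cancel₀ hc.ne' h)
  set h : ℝ → ℝ := fun t => Real.exp (ν * t) * Real.exp (-(2 * √z) * Real.cosh t) with hh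
  -- The substitution `g = √z e^t` symmetrizes `g + z/g` into `2√z cosh t`.
  have heq : ∀ t : ℝ, |√z * Real.exp t| • ((√z * Real.exp t) ^ (ν - 1) *
      Real.exp (-(√z * Real.exp t) - z / (√z * Real.exp t))) = z ^ (ν / 2) * h t := by
    intro t
    have hpos : 0 < √z * Real.exp t := by positivity
    have h1 : √z ^ ν = z ^ (ν / 2) := by
      rw [Real.sqrt_eq_rpow, ← Real.rpow_mul hz.le]; congr 1; ring
    have h2 : z / (√z * Real.exp t) = √z * Real.exp (-t) := by
      rw [Real.exp_neg, div_eq_iff hpos.ne']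
      field_simp
      nlinarith
    rw [abs_of_pos hpos, smul_eq_mul, ← mul_assoc, Real.rpow_sub_one hpos.ne',
      mul_div_cancel₀ _ hpos.ne', Real.mul_rpow hc.le (Real.exp_pos t).le, h1, h2, mul_assoc, hh]
    simp only
    rw [← Real.exp_mul, mul_comm t ν, Real.cosh_eq]
    congr 3
    ring
  have hI := integral_image_eq_integral_abs_deriv_smul MeasurableSet.univ hder hinj
    (fun g => g ^ (ν - 1) * Real.exp (-g - z / g))
  have hint : Integrable h := by
    have h1 := (integrableOn_image_iff_integrableOn_abs_deriv_smul MeasurableSet.univ hder hinj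
      (fun g => g ^ (ν - 1) * Real.exp (-g - z / g))).1 (by
        rw [image_mul_exp_univ hc]
        exact integrableOn_rpow_mul_exp_neg_sub_div hν hz.le)
    simp only [heq] at h1
    rw [integrableOn_univ] at h1
    have hz2 : z ^ (ν / 2) ≠ 0 := by positivity
    exact (integrable_const_mul_iff (IsUnit.mk0 _ hz2) _).1 h1
  rw [image_mul_exp_univ hc] at hI
  simp only [heq] at hI
  rw [hI, setIntegral_univ, integral_const_mul,
    ← intervalIntegral.integral_Iic_add_Ioi hint.integrableOn hint.integrableOn (b := 0)]
  -- Folding the negative half-line onto the positive one turns `e^{νt}` into `e^{νt} + e^{-νt} = 2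
  -- cosh (νt)`.
  have hneg : ∫ t in Set.Iic (0 : ℝ), h t = ∫ t in Set.Ioi (0 : ℝ), h (-t) := by
    have := integral_comp_neg_Ioi (0 : ℝ) h
    rw [this, neg_zero]
  have hint2 : IntegrableOn (fun t => h (-t)) (Set.Ioi 0) := hint.comp_neg.integrableOn
  have hsum : ∫ t in Set.Ioi (0 : ℝ), (h (-t) + h t) = 2 * besselK ν (2 * √z) := by
    rw [besselK, ← integral_const_mul]
    refine setIntegral_congr_fun measurableSet_Ioi fun t _ => ?_
    simp only [hh, Real.cosh_neg]
    rw [Real.cosh_eq (ν * t), mul_neg]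
    ring
  rw [hneg, ← integral_add hint2 hint.integrableOn, hsum]
  ring

/-- Integrating `e^{-z/g}` against the Gamma density gives exactly the Bessel integral. This links
the closed forms to probabilities. -/
lemma bracket_eq_gainCdf (c : Params) (hQ : 1 ≤ c.Q) {z : ℝ} (hz : 0 < z) :
    c.bracket z = gainCdf c.Q z := by
  have := isProbabilityMeasure_gammaMeasure_natCast hQ
  have hQ0 : (0 : ℝ) < c.Q := by exact_mod_cast hQ
  have hint : Integrable (fun g => Real.exp (-(max z 0 / g))) (gammaMeasure c.Q 1) := by
    have := (integrable_const (1 : ℝ)).sub (gainCdf_integrable hQ z)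
    refine this.congr (ae_of_all _ fun g => ?_)
    simp
  rw [gainCdf, integral_sub (integrable_const _) hint, Params.bracket, integral_const,
    probReal_univ, one_smul, integral_gammaMeasure hQ0, max_eq_left hz.le]
  have h1 : ∫ x in Set.Ioi (0 : ℝ),
      (x ^ ((c.Q : ℝ) - 1) * Real.exp (-x) / Real.Gamma c.Q) • Real.exp (-(z / x)) =
      (∫ x in Set.Ioi (0 : ℝ), x ^ ((c.Q : ℝ) - 1) * Real.exp (-x - z / x)) / Real.Gamma c.Q := by
    rw [← integral_div]
    refine integral_congr_ae (ae_of_all _ fun x => ?_)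
    simp only [smul_eq_mul]
    rw [sub_eq_add_neg (-x), Real.exp_add]
    ring
  rw [h1, integral_rpow_mul_exp_neg_sub_div hQ0 hz]
  ring

end GainCdf

/-! ### Behaviour of the gain distribution at zero. -/

section Asymptotics

/-- The factor `1/g` lowers the shape by one, so the integral is `Γ(a-1)/Γ(a)`. Convergence at `0`
needs `a > 1`, hence the separate case `Q = 1`. -/
lemma gammaMeasure_inv {a : ℝ} (ha : 1 < a) :
    Integrable (fun g : ℝ => g⁻¹) (gammaMeasure a 1) ∧
      ∫ g, g⁻¹ ∂gammaMeasure a 1 = 1 / (a - 1) := by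
  have ha0 : 0 < a := by linarith
  have hG := Real.Gamma_pos_of_pos ha0
  have hG1 := Real.Gamma_pos_of_pos (sub_pos.2 ha)
  have heq : ∀ x ∈ Set.Ioi (0 : ℝ), (x ^ (a - 1) * Real.exp (-x) / Real.Gamma a) • x⁻¹ =
      (Real.exp (-x) * x ^ (a - 1 - 1)) / Real.Gamma a := by
    intro x hx
    have hx' : (0 : ℝ) < x := hx
    rw [Real.rpow_sub_one hx'.ne' (a - 1), smul_eq_mul]
    ring
  have hint := (Real.GammaIntegral_convergent (sub_pos.2 ha)).div_const (Real.Gamma a)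
  constructor
  · rw [gammaMeasure_eq_withDensity, integrable_withDensity_iff_integrable_smul₀' (by fun_prop)
      (by simp)]
    refine IntegrableOn.congr_fun hint (fun x hx => ?_) measurableSet_Ioi
    have hx' : (0 : ℝ) < x := hx
    rw [ENNReal.toReal_ofReal (by positivity), ← heq x hx]
  · rw [integral_gammaMeasure ha0, setIntegral_congr_fun measurableSet_Ioi heq, integral_div,
      ← Real.Gamma_eq_integral (sub_pos.2 ha)]
    have : Real.Gamma a = (a - 1) * Real.Gamma (a - 1) := by
      rw [← Real.Gamma_add_one (sub_pos.2 ha).ne', sub_add_cancel]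
    rw [this]
    field_simp

/-- For `Q ≥ 2` the distribution function of the gain is asymptotically linear at zero. -/
lemma tendsto_gainCdf_div {Q : ℕ} (hQ : 2 ≤ Q) :
    Tendsto (fun z => gainCdf Q z / z) (𝓝[>] 0) (𝓝 (1 / ((Q : ℝ) - 1))) := by
  have hQ1 : (1 : ℝ) < Q := by exact_mod_cast hQ
  obtain ⟨hint, hval⟩ := gammaMeasure_inv hQ1
  rw [← hval]
  simp only [gainCdf, ← integral_div]
  -- The inequality `1 - e^{-x} ≤ x` bounds the difference quotient by `1/g`, which is also its
  -- limit.
  refine tendsto_integral_filter_of_dominated_convergence (fun g => g⁻¹)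
    (Eventually.of_forall fun z => by fun_prop) ?_ hint ?_
  · filter_upwards [self_mem_nhdsWithin] with z hz
    have hz' : (0 : ℝ) < z := hz
    filter_upwards [gammaMeasure_ae_pos Q] with g hg
    rw [max_eq_left hz'.le]
    have h1 := one_sub_exp_neg_mem (x := z / g) (by positivity)
    rw [Real.norm_of_nonneg (div_nonneg h1.1 hz'.le), div_le_iff₀ hz']
    have h2 := Real.add_one_le_exp (-(z / g))
    rw [inv_mul_eq_div]
    linarith
  · filter_upwards [gammaMeasure_ae_pos Q] with g hg
    have hd : HasDerivAt (fun z : ℝ => 1 - Real.exp (-(z / g))) g⁻¹ 0 := by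
      have h1 : HasDerivAt (fun z : ℝ => -(z / g)) (-(1 / g)) 0 :=
        ((hasDerivAt_id (0 : ℝ)).div_const g).neg
      have h2 := h1.exp.const_sub 1
      refine h2.congr_deriv ?_
      simp
    have h3 := hd.tendsto_slope_zero_right
    refine h3.congr' ?_
    filter_upwards [self_mem_nhdsWithin] with z hz
    have hz' : (0 : ℝ) < z := hz
    rw [max_eq_left hz'.le]
    simp [div_eq_inv_mul]

lemma gainCdf_one_eq {u : ℝ} (hu : 0 < u) : gainCdf 1 u =
    ∫ g in Set.Ioi (0 : ℝ), Real.exp (-g) * (1 - Real.exp (-(u / g))) := by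
  rw [gainCdf, Nat.cast_one, max_eq_left hu.le]
  exact integral_expMeasure _

lemma integrableOn_gainCdf_one {u : ℝ} (hu : 0 < u) :
    IntegrableOn (fun g : ℝ => Real.exp (-g) * (1 - Real.exp (-(u / g)))) (Set.Ioi 0) := by
  have h := gainCdf_integrable le_rfl u
  rw [Nat.cast_one, max_eq_left hu.le] at h
  exact integrable_expMeasure_iff.1 h

/-- On `(0, 1]`, use `e^{-g} ≥ 1 - g` and `1 - e^{-u/g} ≥ u/(g+u)`. Their product is at least
`u/(g+u) - u`, with integral `u log(1+u) - u log u - u`. -/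
lemma le_gainCdf_one {u : ℝ} (hu : 0 < u) : -(u * Real.log u) - u ≤ gainCdf 1 u := by
  rw [gainCdf_one_eq hu]
  have hint := integrableOn_gainCdf_one hu
  have hsub : ∫ g in Set.Ioc (0 : ℝ) 1, Real.exp (-g) * (1 - Real.exp (-(u / g))) ≤
      ∫ g in Set.Ioi (0 : ℝ), Real.exp (-g) * (1 - Real.exp (-(u / g))) := by
    refine setIntegral_mono_set hint ?_ (Set.Ioc_subset_Ioi_self.eventuallyLE)
    filter_upwards [ae_restrict_mem measurableSet_Ioi] with g hg
    have hg' : (0 : ℝ) < g := hg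
    exact mul_nonneg (Real.exp_pos _).le
      (one_sub_exp_neg_mem (x := u / g) (by positivity)).1
  refine le_trans ?_ hsub
  have hder : ∀ g ∈ Set.uIcc (0 : ℝ) 1,
      HasDerivAt (fun g => u * Real.log (g + u) - u * g) (u / (g + u) - u) g := by
    intro g hg
    rw [Set.uIcc_of_le zero_le_one] at hg
    have : g + u ≠ 0 := by have := hg.1; positivity
    have h1 := (((hasDerivAt_id g).add_const u).log this).const_mul u
    have h2 := (hasDerivAt_id g).const_mul u
    refine (h1.sub h2).congr_deriv ?_
    simp [div_eq_mul_inv]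
  have hcont : ContinuousOn (fun g : ℝ => u / (g + u) - u) (Set.uIcc 0 1) := by
    rw [Set.uIcc_of_le zero_le_one]
    refine ContinuousOn.sub (ContinuousOn.div (by fun_prop) (by fun_prop) fun g hg => ?_)
      (by fun_prop)
    have := hg.1; positivity
  have hI := intervalIntegral.integral_eq_sub_of_hasDerivAt hder hcont.intervalIntegrable
  rw [intervalIntegral.integral_of_le zero_le_one] at hI
  have hle : ∫ g in Set.Ioc (0 : ℝ) 1, (u / (g + u) - u) ≤
      ∫ g in Set.Ioc (0 : ℝ) 1, Real.exp (-g) * (1 - Real.exp (-(u / g))) := by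
    refine setIntegral_mono_on ?_ (hint.mono_set Set.Ioc_subset_Ioi_self) measurableSet_Ioc
      fun g hg => ?_
    · exact (intervalIntegrable_iff_integrableOn_Ioc_of_le zero_le_one).1
        hcont.intervalIntegrable
    · have hg0 := hg.1
      have hgu : 0 < g + u := by positivity
      have h1 : u / (g + u) ≤ 1 - Real.exp (-(u / g)) := by
        have h2 := Real.add_one_le_exp (u / g)
        rw [Real.exp_neg]
        have h3 : (Real.exp (u / g))⁻¹ ≤ (u / g + 1)⁻¹ :=
          inv_anti₀ (by positivity) h2
        have h4 : (u / g + 1)⁻¹ = 1 - u / (g + u) := by field_simp; ring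
        linarith
      have h5 : 1 - g ≤ Real.exp (-g) := by linarith [Real.add_one_le_exp (-g)]
      have h6 : (1 - g) * (u / (g + u)) ≤ Real.exp (-g) * (1 - Real.exp (-(u / g))) :=
        mul_le_mul h5 h1 (by positivity) (Real.exp_pos _).le
      have h7 : u / (g + u) - u ≤ (1 - g) * (u / (g + u)) := by
        have : g * (u / (g + u)) ≤ u := by
          rw [← mul_div_assoc, div_le_iff₀ hgu]; nlinarith
        linarith
      exact h7.trans h6
  rw [hI] at hle
  refine le_trans ?_ hle
  have : 0 ≤ Real.log (1 + u) := Real.log_nonneg (by linarith)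
  simp only [zero_add, mul_one, mul_zero, sub_zero]
  nlinarith

/-- Split at `u` and `1`, bounding the integrand by `1`, by `u/g` and by `u e^{-g}`. The middle
piece gives `-u log u`; each outer piece gives at most `u`. -/
lemma gainCdf_one_le {u : ℝ} (hu : 0 < u) (hu1 : u < 1) :
    gainCdf 1 u ≤ -(u * Real.log u) + 2 * u := by
  rw [gainCdf_one_eq hu]
  have hint := integrableOn_gainCdf_one hu
  have hi1 := hint.mono_set (Set.Ioc_subset_Ioi_self : Set.Ioc 0 u ⊆ Set.Ioi 0)
  have hi2 := hint.mono_set (Set.Ioi_subset_Ioi hu.le)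
  have hi3 := hint.mono_set ((Set.Ioc_subset_Ioi_self : Set.Ioc u 1 ⊆ Set.Ioi u).trans
    (Set.Ioi_subset_Ioi hu.le))
  have hi4 := hint.mono_set (Set.Ioi_subset_Ioi (zero_le_one (α := ℝ)))
  have hle1 : ∀ g : ℝ, 0 < g → Real.exp (-g) ≤ 1 := fun g hg => by
    rw [Real.exp_le_one_iff]; linarith
  have hle2 : ∀ g : ℝ, 1 - Real.exp (-(u / g)) ≤ u / g := fun g => by
    linarith [Real.add_one_le_exp (-(u / g))]
  have hmem : ∀ g : ℝ, 0 < g → 0 ≤ 1 - Real.exp (-(u / g)) ∧ 1 - Real.exp (-(u / g)) ≤ 1 :=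
    fun g hg => one_sub_exp_neg_mem (by positivity)
  rw [← Set.Ioc_union_Ioi_eq_Ioi hu.le, setIntegral_union Set.Ioc_disjoint_Ioi_same
    measurableSet_Ioi hi1 hi2, ← Set.Ioc_union_Ioi_eq_Ioi hu1.le,
    setIntegral_union Set.Ioc_disjoint_Ioi_same measurableSet_Ioi hi3 hi4]
  have b1 : ∫ g in Set.Ioc 0 u, Real.exp (-g) * (1 - Real.exp (-(u / g))) ≤ u := by
    calc _ ≤ ∫ _ in Set.Ioc 0 u, (1 : ℝ) := by
          refine setIntegral_mono_on hi1 (by simp) measurableSet_Ioc fun g hg => ?_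
          exact mul_le_one₀ (hle1 g hg.1) (hmem g hg.1).1 (hmem g hg.1).2
      _ = u := by simp [hu.le]
  have b2 : ∫ g in Set.Ioc u 1, Real.exp (-g) * (1 - Real.exp (-(u / g))) ≤
      -(u * Real.log u) := by
    have hcont : ContinuousOn (fun g : ℝ => u * (1 / g)) (Set.uIcc u 1) := by
      rw [Set.uIcc_of_le hu1.le]
      refine ContinuousOn.mul (by fun_prop) (ContinuousOn.div (by fun_prop) (by fun_prop) ?_)
      intro g hg
      exact (hu.trans_le hg.1).ne'
    calc _ ≤ ∫ g in Set.Ioc u 1, u * (1 / g) := by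
          refine setIntegral_mono_on hi3 ?_ measurableSet_Ioc fun g hg => ?_
          · exact (intervalIntegrable_iff_integrableOn_Ioc_of_le hu1.le).1
              hcont.intervalIntegrable
          · have hg0 := hu.trans hg.1
            rw [mul_one_div]
            calc _ ≤ 1 * (u / g) := mul_le_mul (hle1 g hg0) (hle2 g) (hmem g hg0).1 zero_le_one
              _ = _ := one_mul _
      _ = -(u * Real.log u) := by
          rw [← intervalIntegral.integral_of_le hu1.le, intervalIntegral.integral_const_mul,
            integral_one_div_of_pos hu one_pos, one_div, Real.log_inv]
          ring
  have b3 : ∫ g in Set.Ioi 1, Real.exp (-g) * (1 - Real.exp (-(u / g))) ≤ u := by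
    have hexp := (integrableOn_exp_neg_Ioi 1).const_mul u
    calc _ ≤ ∫ g in Set.Ioi (1 : ℝ), u * Real.exp (-g) := by
          refine setIntegral_mono_on hi4 hexp measurableSet_Ioi fun g hg => ?_
          have hg1 : (1 : ℝ) < g := hg
          rw [mul_comm u]
          gcongr
          exact (hle2 g).trans (div_le_self hu.le hg1.le)
      _ ≤ u := by
          rw [integral_const_mul, integral_exp_neg_Ioi]
          exact mul_le_of_le_one_right hu.le (hle1 1 one_pos)
  linarith

/-- For `Q = 1` the distribution function of the gain behaves like `-u log u` at zero. -/
lemma tendsto_gainCdf_one_div :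
    Tendsto (fun u => gainCdf 1 u / -(u * Real.log u)) (𝓝[>] 0) (𝓝 1) := by
  have hlog : Tendsto (fun u : ℝ => (-Real.log u)⁻¹) (𝓝[>] 0) (𝓝 0) :=
    (tendsto_neg_atBot_atTop.comp Real.tendsto_log_nhdsGT_zero).inv_tendsto_atTop
  have h1 : Tendsto (fun u : ℝ => 1 - (-Real.log u)⁻¹) (𝓝[>] 0) (𝓝 1) := by
    simpa using hlog.const_sub 1
  have h2 : Tendsto (fun u : ℝ => 1 + 2 * (-Real.log u)⁻¹) (𝓝[>] 0) (𝓝 1) := by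
    simpa using (hlog.const_mul 2).const_add 1
  have hev : ∀ᶠ u : ℝ in 𝓝[>] 0, 0 < u ∧ u < 1 :=
    Ioo_mem_nhdsGT one_pos
  refine tendsto_of_tendsto_of_tendsto_of_le_of_le' h1 h2 ?_ ?_
  · filter_upwards [hev] with u hu
    have hl : 0 < -Real.log u := by linarith [Real.log_neg hu.1 hu.2]
    have hd : 0 < -(u * Real.log u) := by have := mul_pos hu.1 hl; linarith
    rw [le_div_iff₀ hd]
    refine le_trans (le_of_eq ?_) (le_gainCdf_one hu.1)
    have : Real.log u ≠ 0 := by intro h; simp [h] at hl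
    field_simp
    ring
  · filter_upwards [hev] with u hu
    have hl : 0 < -Real.log u := by linarith [Real.log_neg hu.1 hu.2]
    have hd : 0 < -(u * Real.log u) := by have := mul_pos hu.1 hl; linarith
    rw [div_le_iff₀ hd]
    refine (gainCdf_one_le hu.1 hu.2).trans (le_of_eq ?_)
    have : Real.log u ≠ 0 := by intro h; simp [h] at hl
    field_simp
    ring

end Asymptotics

/-! ### Order statistics and their distribution function. -/

section OrderStatistics

/-- For the converse direction, the largest of the finitely many values below `t` is itself below
`t` and belongs to the set whose infimum is taken. -/
lemma orderStat_lt_iff {K : ℕ} (x : Fin K → ℝ) {k : ℕ} (hk : 1 ≤ k) (hkK : k ≤ K) (t : ℝ) :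
    orderStat x k < t ↔ k ≤ (Finset.univ.filter fun i => x i < t).card := by
  have hne0 : (Finset.univ : Finset (Fin K)).Nonempty :=
    Finset.card_pos.1 (by rw [Finset.card_univ, Fintype.card_fin]; omega)
  have hbdd : BddBelow {t : ℝ | k ≤ (Finset.univ.filter fun i => x i ≤ t).card} := by
    refine ⟨Finset.univ.inf' hne0 x, fun s hs => ?_⟩
    obtain ⟨i, hi⟩ := Finset.card_pos.1 (lt_of_lt_of_le hk hs)
    exact (Finset.inf'_le x (Finset.mem_univ i)).trans (Finset.mem_filter.1 hi).2
  have hne : {t : ℝ | k ≤ (Finset.univ.filter fun i => x i ≤ t).card}.Nonempty := by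
    refine ⟨Finset.univ.sup' hne0 x, ?_⟩
    have : (Finset.univ.filter fun i => x i ≤ Finset.univ.sup' hne0 x) = Finset.univ :=
      Finset.filter_true_of_mem fun i hi => Finset.le_sup' x hi
    rw [Set.mem_ofPred_eq, this, Finset.card_univ, Fintype.card_fin]
    exact hkK
  constructor
  · intro h
    obtain ⟨s, hs, hst⟩ := exists_lt_of_csInf_lt hne h
    refine le_trans hs (Finset.card_le_card fun i hi => ?_)
    rw [Finset.mem_filter] at hi ⊢
    exact ⟨hi.1, hi.2.trans_lt hst⟩
  · intro h
    have hne1 : (Finset.univ.filter fun i => x i < t).Nonempty :=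
      Finset.card_pos.1 (lt_of_lt_of_le hk h)
    have hlt : (Finset.univ.filter fun i => x i < t).sup' hne1 x < t := by
      rw [Finset.sup'_lt_iff]
      exact fun i hi => (Finset.mem_filter.1 hi).2
    refine lt_of_le_of_lt (csInf_le hbdd ?_) hlt
    refine le_trans h (Finset.card_le_card fun i hi => ?_)
    rw [Finset.mem_filter]
    exact ⟨Finset.mem_univ _, Finset.le_sup' x hi⟩

open Classical in
lemma le_card_filter_iff {ι : Type*} [Fintype ι] (p : ι → Prop) (k : ℕ) :
    k ≤ (Finset.univ.filter p).card ↔ ∃ S : Finset ι, k ≤ S.card ∧ ∀ i ∈ S, p i := by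
  constructor
  · exact fun h => ⟨_, h, fun i hi => (Finset.mem_filter.1 hi).2⟩
  · rintro ⟨S, hS, hp⟩
    exact hS.trans (Finset.card_le_card fun i hi => Finset.mem_filter.2 ⟨Finset.mem_univ _, hp i hi⟩)

lemma measurable_orderStat {α : Type*} [MeasurableSpace α] {K : ℕ} {f : Fin K → α → ℝ}
    (hf : ∀ i, Measurable (f i)) {k : ℕ} (hk : 1 ≤ k) (hkK : k ≤ K) :
    Measurable fun ω => orderStat (fun i => f i ω) k := by
  classical
  refine measurable_of_Iio fun t => ?_
  have : (fun ω => orderStat (fun i => f i ω) k) ⁻¹' Set.Iio t =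
      ⋃ S ∈ {S : Finset (Fin K) | k ≤ S.card}, ⋂ i ∈ S, {ω | f i ω < t} := by
    ext ω
    simp only [Set.mem_preimage, Set.mem_Iio, orderStat_lt_iff _ hk hkK]
    have h := le_card_filter_iff (fun i => f i ω < t) k
    simp only [Set.mem_iUnion, Set.mem_iInter, Set.mem_ofPred_eq, exists_prop]
    convert h
  rw [this]
  exact MeasurableSet.biUnion (Set.toFinite _).countable fun S _ =>
    Finset.measurableSet_biInter _ fun i _ => hf i measurableSet_Iio

/-- The upper tail of the binomial distribution, as a sum over the sets of successes. -/
noncomputable def binomialTail (K k : ℕ) (x : ℝ) : ℝ :=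
  ∑ S : Finset (Fin K) with k ≤ S.card, x ^ S.card * (1 - x) ^ (K - S.card)

/-- Partition the event by the exact set `S` of successes; each piece is a box, whose product
measure is explicit. -/
lemma pi_real_le_card_filter {α : Type*} [MeasurableSpace α] (μ : Measure α)
    [IsProbabilityMeasure μ] {A : Set α} (hA : MeasurableSet A) (K k : ℕ)
    [DecidablePred (· ∈ A)] :
    (Measure.pi fun _ : Fin K => μ).real
      {ω | k ≤ (Finset.univ.filter fun i => ω i ∈ A).card} = binomialTail K k (μ.real A) := by
  classical
  set B : Finset (Fin K) → Set (Fin K → α) := fun S =>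
    Set.univ.pi fun i => if i ∈ S then A else Aᶜ with hB
  have hmem : ∀ (S : Finset (Fin K)) (ω : Fin K → α),
      ω ∈ B S ↔ (Finset.univ.filter fun i => ω i ∈ A) = S := by
    intro S ω
    simp only [hB, Set.mem_univ_pi, Finset.ext_iff, Finset.mem_filter, Finset.mem_univ, true_and]
    refine forall_congr' fun i => ?_
    by_cases h : i ∈ S <;> simp [h]
  have hBm : ∀ S, MeasurableSet (B S) := fun S => MeasurableSet.univ_pi fun i => by
    split_ifs
    · exact hA
    · exact hA.compl
  have hunion : {ω : Fin K → α | k ≤ (Finset.univ.filter fun i => ω i ∈ A).card} =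
      ⋃ S ∈ (Finset.univ.filter fun S : Finset (Fin K) => k ≤ S.card), B S := by
    ext ω
    simp only [Set.mem_ofPred_eq, Set.mem_iUnion, hmem, Finset.mem_filter, Finset.mem_univ,
      true_and, exists_prop, exists_eq_right']
  rw [hunion, measureReal_biUnion_finset (fun S _ T _ hST => ?_) (fun S _ => hBm S), binomialTail]
  · refine Finset.sum_congr rfl fun S _ => ?_
    rw [hB, measureReal_def, Measure.pi_pi, ENNReal.toReal_prod]
    have : ∀ i, (μ (if i ∈ S then A else Aᶜ)).toReal =
        if i ∈ S then μ.real A else 1 - μ.real A := by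
      intro i
      split_ifs
      · rfl
      · exact probReal_compl_eq_one_sub hA
    simp only [this]
    rw [Finset.prod_ite, Finset.prod_const, Finset.prod_const, Finset.filter_mem_eq_inter,
      Finset.univ_inter]
    congr 2
    rw [← Finset.compl_filter, Finset.filter_mem_eq_inter, Finset.univ_inter, Finset.card_compl,
      Fintype.card_fin]
  · rw [Function.onFun, Set.disjoint_left]
    intro ω h1 h2
    exact hST (((hmem S ω).1 h1).symm.trans ((hmem T ω).1 h2))

lemma binomialTail_nonneg (K k : ℕ) {x : ℝ} (h0 : 0 ≤ x) (h1 : x ≤ 1) :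
    0 ≤ binomialTail K k x := by
  have : 0 ≤ 1 - x := by linarith
  exact Finset.sum_nonneg fun S _ => by positivity

lemma binomialTail_pos {K k : ℕ} (hkK : k ≤ K) {x : ℝ} (h0 : 0 < x) (h1 : x ≤ 1) :
    0 < binomialTail K k x := by
  have : 0 ≤ 1 - x := by linarith
  refine Finset.sum_pos' (fun S _ => by positivity) ⟨Finset.univ, by simpa using hkK, ?_⟩
  simp only [Finset.card_univ, Fintype.card_fin, Nat.sub_self, pow_zero, mul_one]
  positivity

lemma binomialTail_le_one (K k : ℕ) {x : ℝ} (h0 : 0 ≤ x) (h1 : x ≤ 1) :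
    binomialTail K k x ≤ 1 := by
  have h2 : 0 ≤ 1 - x := by linarith
  have := Fintype.sum_pow_mul_eq_add_pow (Fin K) x (1 - x)
  rw [add_sub_cancel, one_pow, Fintype.card_fin] at this
  rw [← this]
  exact Finset.sum_le_sum_of_subset_of_nonneg (Finset.filter_subset _ _) fun S _ _ => by positivity

lemma binomialTail_eq_sum_bernstein (K m : ℕ) (hm : m + 1 ≤ K) (x : ℝ) :
    binomialTail K (m + 1) x =
      ∑ i ∈ Finset.range (K - m), (bernsteinPolynomial ℝ K (m + i + 1)).eval x := by
  have h1 : binomialTail K (m + 1) x = ∑ S : Finset (Fin K),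
      if m + 1 ≤ S.card then x ^ S.card * (1 - x) ^ (K - S.card) else 0 := by
    rw [binomialTail, Finset.sum_filter]
  have h2 := Finset.sum_powerset_apply_card (x := (Finset.univ : Finset (Fin K)))
    (fun j => if m + 1 ≤ j then x ^ j * (1 - x) ^ (K - j) else (0 : ℝ))
  rw [Finset.powerset_univ, Finset.card_univ, Fintype.card_fin] at h2
  rw [h1, h2]
  have h3 : K + 1 = (m + 1) + (K - m) := by omega
  rw [h3, Finset.sum_range_add, Finset.sum_eq_zero, zero_add]
  · refine Finset.sum_congr rfl fun i _ => ?_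
    rw [if_pos (by omega), bernsteinPolynomial]
    simp only [Polynomial.eval_mul, Polynomial.eval_natCast, Polynomial.eval_pow,
      Polynomial.eval_X, Polynomial.eval_sub, Polynomial.eval_one, nsmul_eq_mul]
    rw [show m + 1 + i = m + i + 1 by ring]
    ring
  · intro i hi
    have := Finset.mem_range.1 hi
    rw [if_neg (by omega), smul_zero]

/-- The distribution function of the `k`-th order statistic in terms of that of one sample. -/
noncomputable def Params.orderCdf (c : Params) (k : ℕ) (x : ℝ) : ℝ :=
  c.κ k * ∑ l ∈ Finset.range (c.K - k + 1),
    ((c.K - k).choose l : ℝ) * ((-1 : ℝ) ^ l / ((k : ℝ) + l)) * x ^ (k + l)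

/-- Differentiation cancels the denominators `k + l`, and the binomial theorem resums the rest to a
Beta density. -/
lemma hasDerivAt_orderCdf (c : Params) {k : ℕ} (hk : 1 ≤ k) (x : ℝ) :
    HasDerivAt (c.orderCdf k) (c.κ k * (x ^ (k - 1) * (1 - x) ^ (c.K - k))) x := by
  have h : HasDerivAt (c.orderCdf k) (c.κ k * ∑ l ∈ Finset.range (c.K - k + 1),
      ((c.K - k).choose l : ℝ) * ((-1 : ℝ) ^ l / ((k : ℝ) + l)) *
        (((k + l : ℕ) : ℝ) * x ^ (k + l - 1))) x :=
    (HasDerivAt.fun_sum fun l _ => (hasDerivAt_pow (k + l) x).const_mul _).const_mul _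
  refine h.congr_deriv ?_
  congr 1
  rw [sub_eq_add_neg, add_comm (1 : ℝ), add_pow, Finset.mul_sum]
  refine Finset.sum_congr rfl fun l _ => ?_
  have hkl : (k : ℝ) + l ≠ 0 := by positivity
  rw [show k + l - 1 = (k - 1) + l by omega, pow_add, neg_pow x l]
  push_cast
  field_simp
  simp

/-- The derivative of each Bernstein polynomial is `K` times a difference of two consecutive ones of
degree `K - 1`. The sum telescopes, and its upper end vanishes because the index exceeds the degree.
-/
lemma hasDerivAt_binomialTail {K m : ℕ} (hm : m + 1 ≤ K) (x : ℝ) :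
    HasDerivAt (binomialTail K (m + 1))
      (K * ((K - 1).choose m * x ^ m * (1 - x) ^ (K - 1 - m))) x := by
  have h1 : binomialTail K (m + 1) = fun x =>
      ∑ i ∈ Finset.range (K - m), (bernsteinPolynomial ℝ K (m + i + 1)).eval x :=
    funext fun x => binomialTail_eq_sum_bernstein K m hm x
  rw [h1]
  have h2 : HasDerivAt (fun x => ∑ i ∈ Finset.range (K - m),
      (bernsteinPolynomial ℝ K (m + i + 1)).eval x) (∑ i ∈ Finset.range (K - m),
      (Polynomial.derivative (bernsteinPolynomial ℝ K (m + i + 1))).eval x) x :=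
    HasDerivAt.fun_sum fun i _ => Polynomial.hasDerivAt _ x
  refine h2.congr_deriv ?_
  simp only [bernsteinPolynomial.derivative_succ, Polynomial.eval_mul, Polynomial.eval_natCast,
    Polynomial.eval_sub]
  rw [← Finset.mul_sum]
  have h3 := Finset.sum_range_sub'
    (fun i => (bernsteinPolynomial ℝ (K - 1) (m + i)).eval x) (K - m)
  simp only [add_assoc] at h3 ⊢
  rw [h3, bernsteinPolynomial.eq_zero_of_lt ℝ (show K - 1 < m + (K - m) by omega)]
  simp [bernsteinPolynomial]

lemma κ_eq (c : Params) {k : ℕ} (hk : 1 ≤ k) (hkK : k ≤ c.K) :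
    c.κ k = c.K * (c.K - 1).choose (k - 1) := by
  have h1 := Nat.choose_mul_factorial_mul_factorial (show k - 1 ≤ c.K - 1 by omega)
  rw [show c.K - 1 - (k - 1) = c.K - k by omega] at h1
  have h2 := Nat.mul_factorial_pred (show c.K ≠ 0 by omega)
  rw [Params.κ, div_eq_iff (by positivity), ← h2, ← h1]
  push_cast
  ring

lemma κ_pos (c : Params) (k : ℕ) : 0 < c.κ k := by
  rw [Params.κ]; positivity

/-- The two expressions of the distribution function of an order statistic. -/
lemma binomialTail_eq_orderCdf (c : Params) {k : ℕ} (hk : 1 ≤ k) (hkK : k ≤ c.K) (x : ℝ) :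
    binomialTail c.K k x = c.orderCdf k x := by
  obtain ⟨m, rfl⟩ := Nat.exists_eq_add_of_le' hk
  -- Both functions have the same derivative and vanish at `0`.
  have hder : ∀ x, HasDerivAt (fun x => binomialTail c.K (m + 1) x - c.orderCdf (m + 1) x) 0 x := by
    intro x
    refine ((hasDerivAt_binomialTail hkK x).sub (hasDerivAt_orderCdf c hk x)).congr_deriv ?_
    rw [κ_eq c hk hkK, Nat.add_sub_cancel, show c.K - 1 - m = c.K - (m + 1) by omega]
    ring
  have hconst := is_const_of_deriv_eq_zero (fun x => (hder x).differentiableAt)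
    (fun x => (hder x).deriv) x 0
  have h1 : binomialTail c.K (m + 1) 0 = 0 := Finset.sum_eq_zero fun S hS => by
    have : m + 1 ≤ S.card := (Finset.mem_filter.1 hS).2
    rw [zero_pow (by omega), zero_mul]
  have h2 : c.orderCdf (m + 1) 0 = 0 := by
    rw [Params.orderCdf, Finset.sum_eq_zero, mul_zero]
    intro l _
    rw [zero_pow (by omega), mul_zero]
  simp only [h1, h2, sub_zero] at hconst
  linarith

lemma continuous_orderCdf (c : Params) (k : ℕ) : Continuous (c.orderCdf k) := by
  unfold Params.orderCdf
  fun_prop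

/-- After division by `x^k` only the term `l = 0` survives at `x = 0`. -/
lemma tendsto_orderCdf_div (c : Params) {k : ℕ} (hk : 1 ≤ k) :
    Tendsto (fun x => c.orderCdf k x / (c.κ k / k * x ^ k)) (𝓝[>] 0) (𝓝 1) := by
  have hκ := κ_pos c k
  have hk0 : (0 : ℝ) < k := by exact_mod_cast hk
  have h1 : Continuous fun x : ℝ => k * ∑ l ∈ Finset.range (c.K - k + 1),
      ((c.K - k).choose l : ℝ) * ((-1 : ℝ) ^ l / ((k : ℝ) + l)) * x ^ l := by fun_prop
  have h2 := (h1.tendsto 0).mono_left (nhdsWithin_le_nhds (s := Set.Ioi 0))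
  have h3 : (k : ℝ) * ∑ l ∈ Finset.range (c.K - k + 1),
      ((c.K - k).choose l : ℝ) * ((-1 : ℝ) ^ l / ((k : ℝ) + l)) * 0 ^ l = 1 := by
    rw [Finset.sum_range_succ', Finset.sum_eq_zero]
    · simp [hk0.ne']
    · intro i _
      simp
  rw [h3] at h2
  refine h2.congr' ?_
  filter_upwards [self_mem_nhdsWithin] with x hx
  have hx' : (0 : ℝ) < x := hx
  rw [eq_div_iff (by positivity), Params.orderCdf, Finset.mul_sum, Finset.mul_sum, Finset.sum_mul]
  refine Finset.sum_congr rfl fun l _ => ?_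
  rw [pow_add]
  field_simp

/-- The distribution function of the ordered gain. -/
theorem pi_real_orderedGain_lt (c : Params) (hc : c.Valid) {k : ℕ} (hk : 1 ≤ k) (hkK : k ≤ c.K)
    (t : ℝ) :
    (Measure.pi fun _ : Fin c.K => channelLaw c.P c.Q c.Nbr (c.Nr k)).real
      {h | orderStat (fun i => cascadedGain c.p (h i)) k < t} =
      c.orderCdf k (gainCdf c.Q (t / (c.Nbr * c.Nr k))) := by
  classical
  rw [← channelLaw_real_cascadedGain_lt hc.one_le_Q c.p hc.Nbr_pos (hc.Nr_pos k hk hkK) t,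
    ← binomialTail_eq_orderCdf c hk hkK, ← pi_real_le_card_filter _
      (measurableSet_lt (measurable_cascadedGain c.p) measurable_const)]
  congr 1
  ext h
  rw [Set.mem_ofPred_eq, orderStat_lt_iff _ hk hkK, Set.mem_ofPred_eq]
  refine Iff.of_eq ?_
  congr

end OrderStatistics

/-! ### The outage threshold and its limit at high SNR. -/

namespace Params

variable {c : Params} {k : ℕ} {R ϖ ρ s : ℝ}

lemma Valid.Nr_one_pos (hc : c.Valid) (hk : 1 ≤ k) (hkK : k ≤ c.K) : 0 < c.Nr 1 :=
  hc.Nr_pos 1 le_rfl (hk.trans hkK)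

lemma Valid.ν_nonneg (hc : c.Valid) (k : ℕ) : 0 ≤ c.ν k := by
  refine Finset.sum_nonneg fun i hi => ?_
  rw [Finset.mem_Icc] at hi
  exact hc.a_nonneg i (by omega) hi.2

/-- The distribution function of the ordered gain of user `k`, normalized by `Nbr Nrk`. -/
noncomputable def outCdf (c : Params) (k : ℕ) (x : ℝ) : ℝ := c.orderCdf k (gainCdf c.Q x)

lemma Valid.continuous_outCdf (hc : c.Valid) (k : ℕ) : Continuous (c.outCdf k) :=
  (continuous_orderCdf c k).comp (continuous_gainCdf hc.one_le_Q)

lemma Valid.outCdf_mem (hc : c.Valid) (hk : 1 ≤ k) (hkK : k ≤ c.K) (x : ℝ) :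
    0 ≤ c.outCdf k x ∧ c.outCdf k x ≤ 1 := by
  rw [outCdf, ← binomialTail_eq_orderCdf c hk hkK]
  exact ⟨binomialTail_nonneg _ _ (gainCdf_nonneg _ _) (gainCdf_le_one hc.one_le_Q _),
    binomialTail_le_one _ _ (gainCdf_nonneg _ _) (gainCdf_le_one hc.one_le_Q _)⟩

lemma Valid.norm_outCdf_le_one (hc : c.Valid) (hk : 1 ≤ k) (hkK : k ≤ c.K) (x : ℝ) :
    ‖c.outCdf k x‖ ≤ 1 := by
  have := hc.outCdf_mem hk hkK x
  rw [Real.norm_of_nonneg this.1]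
  exact this.2

lemma Valid.outCdf_pos (hc : c.Valid) (hk : 1 ≤ k) (hkK : k ≤ c.K) {x : ℝ} (hx : 0 < x) :
    0 < c.outCdf k x := by
  rw [outCdf, ← binomialTail_eq_orderCdf c hk hkK]
  exact binomialTail_pos hkK (gainCdf_pos hc.one_le_Q hx) (gainCdf_le_one hc.one_le_Q _)

lemma Valid.vartheta_den_pos (hc : c.Valid) (hk : 1 ≤ k) (hkK : k ≤ c.K) (hϖ : 0 ≤ ϖ)
    (hs : 0 ≤ s) :
    0 < c.ρe * c.Q * c.Nbr * c.Nr 1 * c.ν k + ϖ * c.ρe * c.Nipe * s + 1 := by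
  have := hc.Nr_one_pos hk hkK
  have := hc.ν_nonneg k
  have := hc.Nbr_pos
  have := hc.Nipe_pos
  have := hc.ρe_pos
  positivity

lemma Valid.vartheta_pos (hc : c.Valid) (hk : 1 ≤ k) (hkK : k ≤ c.K) (hR : 0 < R)
    (hϖ : 0 ≤ ϖ) (hs : 0 ≤ s) : 0 < c.vartheta ϖ R k s := by
  have h1 := hc.Nr_one_pos hk hkK
  have h2 := hc.Nbr_pos
  have h3 := hc.ρe_pos
  have h4 := hc.a_nonneg k hk hkK
  have h5 := hc.vartheta_den_pos hk hkK hϖ hs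
  have h6 : 1 < (2 : ℝ) ^ R := Real.one_lt_rpow (by norm_num) hR
  have h7 : 0 ≤ c.Q * c.Nbr * c.Nr 1 * c.a k * c.ρe /
      (c.ρe * c.Q * c.Nbr * c.Nr 1 * c.ν k + ϖ * c.ρe * c.Nipe * s + 1) :=
    div_nonneg (by positivity) h5.le
  rw [vartheta]
  nlinarith

/-- Interference only weakens the eavesdropper. So the single condition `a_k > ς ν_k` makes `a_k -
ϑ(s) ν_k` positive for all `s ≥ 0`. -/
lemma Valid.vartheta_le_varsigma (hc : c.Valid) (hk : 1 ≤ k) (hkK : k ≤ c.K)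
    (hϖ : 0 ≤ ϖ) (hs : 0 ≤ s) : c.vartheta ϖ R k s ≤ c.varsigma R k := by
  have h1 := hc.Nr_one_pos hk hkK
  have h2 := hc.Nbr_pos
  have h3 := hc.ρe_pos
  have h4 := hc.a_nonneg k hk hkK
  have h5 := hc.ν_nonneg k
  have h6 := hc.Nipe_pos
  rw [vartheta, varsigma]
  have : 0 ≤ ϖ * c.ρe * c.Nipe * s := by positivity
  gcongr
  linarith

lemma Valid.sub_vartheta_mul_pos (hc : c.Valid) (hk : 1 ≤ k) (hkK : k ≤ c.K)
    (hadm : c.varsigma R k * c.ν k < c.a k) (hϖ : 0 ≤ ϖ) (hs : 0 ≤ s) :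
    0 < c.a k - c.vartheta ϖ R k s * c.ν k := by
  have := mul_le_mul_of_nonneg_right (hc.vartheta_le_varsigma (R := R) hk hkK hϖ hs) (hc.ν_nonneg k)
  linarith

/-- The normalized outage threshold of the gain of user `k` in terms of the normalized residual
interference powers `s` at the eavesdropper and `d` at the user. -/
noncomputable def outArg (c : Params) (ϖ R : ℝ) (k : ℕ) (ρ s d : ℝ) : ℝ :=
  c.vartheta ϖ R k s * ((ϖ * ρ * c.Nipu * d + 1) / (ρ * c.Nbr * c.Nr k)) /
    (c.a k - c.vartheta ϖ R k s * c.ν k)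

/-- The limit of `outArg` at high SNR. -/
noncomputable def outArgLim (c : Params) (ϖ R : ℝ) (k : ℕ) (s d : ℝ) : ℝ :=
  c.vartheta ϖ R k s * ϖ * c.Nipu * d /
    ((c.a k - c.vartheta ϖ R k s * c.ν k) * c.Nbr * c.Nr k)

lemma Valid.outArg_pos (hc : c.Valid) (hk : 1 ≤ k) (hkK : k ≤ c.K) (hR : 0 < R)
    (hadm : c.varsigma R k * c.ν k < c.a k) (hϖ : 0 ≤ ϖ) (hρ : 0 < ρ) {d : ℝ} (hs : 0 ≤ s)
    (hd : 0 ≤ d) : 0 < c.outArg ϖ R k ρ s d := by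
  have h1 := hc.vartheta_pos hk hkK hR hϖ hs
  have h2 := hc.sub_vartheta_mul_pos hk hkK hadm hϖ hs
  have h3 := hc.Nr_pos k hk hkK
  have h4 := hc.Nbr_pos
  have h5 := hc.Nipu_pos
  rw [outArg]
  positivity

lemma Valid.outArgLim_pos (hc : c.Valid) (hk : 1 ≤ k) (hkK : k ≤ c.K) (hR : 0 < R)
    (hadm : c.varsigma R k * c.ν k < c.a k) (hϖ : 0 < ϖ) {d : ℝ} (hs : 0 ≤ s)
    (hd : 0 < d) : 0 < c.outArgLim ϖ R k s d := by
  have h1 := hc.vartheta_pos hk hkK hR hϖ.le hs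
  have h2 := hc.sub_vartheta_mul_pos hk hkK hadm hϖ.le hs
  have h3 := hc.Nr_pos k hk hkK
  have h4 := hc.Nbr_pos
  have h5 := hc.Nipu_pos
  rw [outArgLim]
  positivity

lemma Valid.tendsto_outArg (hc : c.Valid) (hk : 1 ≤ k) (hkK : k ≤ c.K) (ϖ R s d : ℝ) :
    Tendsto (fun ρ => c.outArg ϖ R k ρ s d) atTop (𝓝 (c.outArgLim ϖ R k s d)) := by
  have h3 := hc.Nr_pos k hk hkK
  have h4 := hc.Nbr_pos
  have h1 : Tendsto (fun ρ : ℝ => c.outArgLim ϖ R k s d +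
      c.vartheta ϖ R k s / (c.Nbr * c.Nr k * (c.a k - c.vartheta ϖ R k s * c.ν k)) * ρ⁻¹) atTop
      (𝓝 (c.outArgLim ϖ R k s d)) := by
    simpa using ((tendsto_inv_atTop_zero (𝕜 := ℝ)).const_mul
      (c.vartheta ϖ R k s / (c.Nbr * c.Nr k * (c.a k - c.vartheta ϖ R k s * c.ν k)))).const_add
      (c.outArgLim ϖ R k s d)
  refine h1.congr' ?_
  filter_upwards [eventually_gt_atTop 0] with ρ hρ
  rw [outArg, outArgLim]
  -- If this denominator is zero, every quotient is `0` by the division convention, so no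
  -- admissibility is needed.
  rcases eq_or_ne (c.a k - c.vartheta ϖ R k s * c.ν k) 0 with h | h
  · simp [h]
  · field_simp

/-! ### The outage probability as an integral over the interference. -/

lemma orderedGain_nonneg (hk : 1 ≤ k) (hkK : k ≤ c.K) (ω : c.Sample) :
    0 ≤ c.orderedGain k ω := by
  by_contra! h
  rw [orderedGain, orderStat_lt_iff _ hk hkK] at h
  obtain ⟨i, hi⟩ := Finset.card_pos.1 (lt_of_lt_of_le hk h)
  have := (Finset.mem_filter.1 hi).2
  rw [cascadedGain] at this
  exact absurd this (not_lt.2 (by positivity))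

lemma Valid.one_add_sinrEve (hc : c.Valid) (hk : 1 ≤ k) (hkK : k ≤ c.K) (ϖ R : ℝ)
    (ω : c.Sample) :
    (2 : ℝ) ^ R * (1 + c.sinrEve ϖ k ω) = c.vartheta ϖ R k (‖ω.2.2‖ ^ 2 / c.Nipe) + 1 := by
  have h6 := hc.Nipe_pos
  have hm : c.meanGainEve = c.Q * c.Nbr * c.Nr 1 :=
    integral_cascadedGain hc.one_le_Q c.p hc.Nbr_pos (hc.Nr_one_pos hk hkK)
  have h1 : ϖ * c.ρe * c.Nipe * (‖ω.2.2‖ ^ 2 / c.Nipe) = ϖ * c.ρe * ‖ω.2.2‖ ^ 2 := by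
    field_simp
  rw [vartheta, sinrEve, hm, h1, sub_add_cancel]
  simp only [mul_assoc]

/-- The outage event in terms of the ordered gain. -/
lemma Valid.secrecyRate_lt_iff (hc : c.Valid) (hk : 1 ≤ k) (hkK : k ≤ c.K) (hR : 0 < R)
    (hadm : c.varsigma R k * c.ν k < c.a k) (hϖ : 0 ≤ ϖ) (hρ : 0 < ρ) (ω : c.Sample) :
    c.secrecyRate ϖ ρ k ω < R ↔ c.orderedGain k ω <
      c.outArg ϖ R k ρ (‖ω.2.2‖ ^ 2 / c.Nipe) (‖ω.2.1‖ ^ 2 / c.Nipu) * (c.Nbr * c.Nr k) := by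
  have hH := orderedGain_nonneg hk hkK ω
  have ha := hc.a_nonneg k hk hkK
  have hν := hc.ν_nonneg k
  have hNe := hc.Nipe_pos
  have hNu := hc.Nipu_pos
  have hNr := hc.Nr_pos k hk hkK
  have hNbr := hc.Nbr_pos
  have hs : 0 ≤ ‖ω.2.2‖ ^ 2 / c.Nipe := by positivity
  have hϑ := hc.vartheta_pos hk hkK hR hϖ hs
  have hsub := hc.sub_vartheta_mul_pos hk hkK hadm hϖ hs
  have hE := hc.one_add_sinrEve hk hkK ϖ R ω
  have h2R : 0 < (2 : ℝ) ^ R := by positivity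
  have hEpos : 0 < 1 + c.sinrEve ϖ k ω := by
    have : 0 < (2 : ℝ) ^ R * (1 + c.sinrEve ϖ k ω) := by rw [hE]; positivity
    exact (mul_pos_iff_of_pos_left h2R).1 this
  have hden : 0 < ρ * c.orderedGain k ω * c.ν k + ϖ * ρ * ‖ω.2.1‖ ^ 2 + 1 := by positivity
  have hUpos : 0 < 1 + c.sinrUser ϖ ρ k ω := by
    rw [sinrUser]; positivity
  have hlog : Real.logb 2 ((2 : ℝ) ^ R * (1 + c.sinrEve ϖ k ω)) =
      R + Real.logb 2 (1 + c.sinrEve ϖ k ω) := by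
    rw [Real.logb_mul h2R.ne' hEpos.ne', Real.logb_rpow (by norm_num) (by norm_num)]
  have h1 : c.secrecyRate ϖ ρ k ω < R ↔
      c.sinrUser ϖ ρ k ω < c.vartheta ϖ R k (‖ω.2.2‖ ^ 2 / c.Nipe) := by
    -- The positive part is immaterial since `R > 0`.
    rw [secrecyRate, max_lt_iff, and_iff_left hR, sub_lt_iff_lt_add, ← hlog,
      Real.logb_lt_logb_iff (by norm_num) hUpos (by positivity), hE]
    constructor <;> intro h <;> linarith
  rw [h1, sinrUser, div_lt_iff₀ hden, outArg]
  set ϑ := c.vartheta ϖ R k (‖ω.2.2‖ ^ 2 / c.Nipe)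
  set H := c.orderedGain k ω
  have h2 : ϑ * ((ϖ * ρ * c.Nipu * (‖ω.2.1‖ ^ 2 / c.Nipu) + 1) / (ρ * c.Nbr * c.Nr k)) /
      (c.a k - ϑ * c.ν k) * (c.Nbr * c.Nr k) =
      ϑ * (ϖ * ρ * ‖ω.2.1‖ ^ 2 + 1) / (ρ * (c.a k - ϑ * c.ν k)) := by
    have := hsub.ne'
    field_simp
  rw [h2, lt_div_iff₀ (by positivity)]
  constructor <;> intro h <;> nlinarith

lemma measurable_vartheta (c : Params) (ϖ R : ℝ) (k : ℕ) : Measurable (c.vartheta ϖ R k) := by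
  unfold vartheta
  fun_prop

lemma measurable_outArg (c : Params) (ϖ R : ℝ) (k : ℕ) (ρ : ℝ) :
    Measurable fun z : ℝ × ℝ => c.outArg ϖ R k ρ z.1 z.2 := by
  have := measurable_vartheta c ϖ R k
  unfold outArg
  fun_prop

lemma measurable_outArgLim (c : Params) (ϖ R : ℝ) (k : ℕ) :
    Measurable fun z : ℝ × ℝ => c.outArgLim ϖ R k z.1 z.2 := by
  have := measurable_vartheta c ϖ R k
  unfold outArgLim
  fun_prop

/-- The joint law of the normalized residual interference powers. -/
lemma Valid.map_interference (hc : c.Valid) :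
    ((complexGaussian c.Nipu).prod (complexGaussian c.Nipe)).map
      (fun w => (‖w.2‖ ^ 2 / c.Nipe, ‖w.1‖ ^ 2 / c.Nipu)) = (expMeasure 1).prod (expMeasure 1) := by
  have key : ∀ N : ℝ, 0 < N →
      (complexGaussian N).map (fun z => ‖z‖ ^ 2 / N) = expMeasure 1 := by
    intro N hN
    have h1 : (fun z : ℂ => ‖z‖ ^ 2 / N) = (fun x : ℝ => x / N) ∘ fun z : ℂ => ‖z‖ ^ 2 := rfl
    rw [h1, ← Measure.map_map (by fun_prop) (by fun_prop), map_norm_sq_complexGaussian hN.le,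
      Measure.map_map (by fun_prop) (by fun_prop)]
    have h2 : (fun x : ℝ => x / N) ∘ (fun x => N * x) = id := by
      ext x
      simp only [Function.comp, id]
      field_simp
    rw [h2, Measure.map_id]
  -- The swap is needed because samples list `h_ipu` first, whereas `outArg` takes the
  -- eavesdropper's power first.
  have h : (fun w : ℂ × ℂ => (‖w.2‖ ^ 2 / c.Nipe, ‖w.1‖ ^ 2 / c.Nipu)) =
      Prod.map (fun z : ℂ => ‖z‖ ^ 2 / c.Nipe) (fun z : ℂ => ‖z‖ ^ 2 / c.Nipu) ∘ Prod.swap := rfl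
  rw [h, ← Measure.map_map (by fun_prop) measurable_swap, Measure.prod_swap,
    ← Measure.map_prod_map _ _ (by fun_prop) (by fun_prop), key _ hc.Nipe_pos, key _ hc.Nipu_pos]

/-- The secrecy outage probability as an expectation over the residual interference. -/
theorem Valid.sop_eq (hc : c.Valid) (hk : 1 ≤ k) (hkK : k ≤ c.K) (hR : 0 < R)
    (hadm : c.varsigma R k * c.ν k < c.a k) (hϖ : 0 ≤ ϖ) (hρ : 0 < ρ) :
    c.sop ϖ R k ρ =
      ∫ z, c.outCdf k (c.outArg ϖ R k ρ z.1 z.2) ∂(expMeasure 1).prod (expMeasure 1) := by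
  have hN : 0 < c.Nbr * c.Nr k := mul_pos hc.Nbr_pos (hc.Nr_pos k hk hkK)
  set θ : ℂ × ℂ → ℝ := fun w =>
    c.outArg ϖ R k ρ (‖w.2‖ ^ 2 / c.Nipe) (‖w.1‖ ^ 2 / c.Nipu) * (c.Nbr * c.Nr k) with hθ
  have hpair : Measurable fun w : ℂ × ℂ => (‖w.2‖ ^ 2 / c.Nipe, ‖w.1‖ ^ 2 / c.Nipu) := by fun_prop
  have hθm : Measurable θ := ((measurable_outArg c ϖ R k ρ).comp hpair).mul_const _
  have hset : {ω | c.secrecyRate ϖ ρ k ω < R} = {ω : c.Sample | c.orderedGain k ω < θ ω.2} := by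
    ext ω
    exact hc.secrecyRate_lt_iff hk hkK hR hadm hϖ hρ ω
  have hH : Measurable fun h : Fin c.K → ChannelVec c.P c.Q × ChannelVec c.P c.Q =>
      orderStat (fun i => cascadedGain c.p (h i)) k :=
    measurable_orderStat (fun i => (measurable_cascadedGain c.p).comp (measurable_pi_apply i)) hk hkK
  have hms : MeasurableSet {ω : c.Sample | c.orderedGain k ω < θ ω.2} :=
    measurableSet_lt (hH.comp measurable_fst) (hθm.comp measurable_snd)
  rw [sop, hset, law, measureReal_def, Measure.prod_apply_symm hms,
    ← integral_toReal (measurable_measure_prodMk_right hms).aemeasurable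
      (ae_of_all _ fun _ => measure_lt_top _ _), ← hc.map_interference,
    integral_map (f := fun z : ℝ × ℝ => c.outCdf k (c.outArg ϖ R k ρ z.1 z.2))
      hpair.aemeasurable ((hc.continuous_outCdf k).measurable.comp
        (measurable_outArg c ϖ R k ρ)).aestronglyMeasurable]
  refine integral_congr_ae (ae_of_all _ fun w => ?_)
  have h1 := pi_real_orderedGain_lt c hc hk hkK (θ w)
  have h2 : θ w / (c.Nbr * c.Nr k) =
      c.outArg ϖ R k ρ (‖w.2‖ ^ 2 / c.Nipe) (‖w.1‖ ^ 2 / c.Nipu) := by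
    rw [hθ]; exact mul_div_cancel_right₀ _ hN.ne'
  rw [h2] at h1
  exact h1

/-! ### Imperfect SIC: the limit and its quadrature approximation. -/

/-- The value of the secrecy outage probability at infinite SNR. -/
noncomputable def sopLim (c : Params) (ϖ R : ℝ) (k : ℕ) : ℝ :=
  ∫ z, c.outCdf k (c.outArgLim ϖ R k z.1 z.2) ∂(expMeasure 1).prod (expMeasure 1)

lemma Valid.tendsto_sop (hc : c.Valid) (hk : 1 ≤ k) (hkK : k ≤ c.K) (hR : 0 < R)
    (hadm : c.varsigma R k * c.ν k < c.a k) (hϖ : 0 ≤ ϖ) :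
    Tendsto (fun ρ => c.sop ϖ R k ρ) atTop (𝓝 (c.sopLim ϖ R k)) := by
  have h : Tendsto (fun ρ => ∫ z, c.outCdf k (c.outArg ϖ R k ρ z.1 z.2)
      ∂(expMeasure 1).prod (expMeasure 1)) atTop (𝓝 (c.sopLim ϖ R k)) := by
    refine tendsto_integral_filter_of_dominated_convergence (fun _ => (1 : ℝ))
      (Eventually.of_forall fun ρ => ((hc.continuous_outCdf k).measurable.comp
        (measurable_outArg c ϖ R k ρ)).aestronglyMeasurable)
      (Eventually.of_forall fun ρ => ae_of_all _ fun z => hc.norm_outCdf_le_one hk hkK _)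
      (integrable_const _) (ae_of_all _ fun z => ?_)
    exact ((hc.continuous_outCdf k).tendsto _).comp (hc.tendsto_outArg hk hkK ϖ R z.1 z.2)
  refine h.congr' ?_
  filter_upwards [eventually_gt_atTop 0] with ρ hρ
  rw [hc.sop_eq hk hkK hR hadm hϖ hρ]

lemma expMeasure_prod_ae_pos :
    ∀ᵐ z ∂(expMeasure 1).prod (expMeasure 1), 0 < z.1 ∧ 0 < z.2 := by
  have h1 := (Measure.quasiMeasurePreserving_fst (μ := expMeasure 1) (ν := expMeasure 1)).ae
    expMeasure_ae_pos
  have h2 := (Measure.quasiMeasurePreserving_snd (μ := expMeasure 1) (ν := expMeasure 1)).ae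
    expMeasure_ae_pos
  exact h1.and h2

/-- For `ϖ > 0` the limiting threshold is positive almost surely, and the gain has positive mass
below any positive level. -/
lemma Valid.sopLim_pos (hc : c.Valid) (hk : 1 ≤ k) (hkK : k ≤ c.K) (hR : 0 < R)
    (hadm : c.varsigma R k * c.ν k < c.a k) (hϖ : 0 < ϖ) : 0 < c.sopLim ϖ R k := by
  have hint : Integrable (fun z : ℝ × ℝ => c.outCdf k (c.outArgLim ϖ R k z.1 z.2))
      ((expMeasure 1).prod (expMeasure 1)) :=
    (integrable_const (1 : ℝ)).mono' ((hc.continuous_outCdf k).measurable.comp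
      (measurable_outArgLim c ϖ R k)).aestronglyMeasurable
      (ae_of_all _ fun z => hc.norm_outCdf_le_one hk hkK _)
  have hnn : ∀ z : ℝ × ℝ, 0 ≤ c.outCdf k (c.outArgLim ϖ R k z.1 z.2) := fun z =>
    (hc.outCdf_mem hk hkK _).1
  refine (integral_nonneg hnn).lt_of_ne fun h => ?_
  have h0 := (integral_eq_zero_iff_of_nonneg hnn hint).1 h.symm
  obtain ⟨z, hz, hz1, hz2⟩ := (h0.and expMeasure_prod_ae_pos).exists
  exact (hc.outCdf_pos hk hkK (hc.outArgLim_pos hk hkK hR hadm hϖ hz1.le hz2)).ne' hz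

/-- The sum over `l` in the closed forms is the order-statistic polynomial evaluated at the Bessel
expression. Positivity of the nodes makes this applicable to every quadrature term. -/
lemma Valid.sum_bracket_eq (hc : c.Valid) {x : ℝ} (hx : 0 < x) (w : ℝ) :
    ∑ l ∈ Finset.range (c.K - k + 1), c.κ k * w * ((c.K - k).choose l : ℝ) *
      ((-1 : ℝ) ^ l / ((k : ℝ) + l)) * c.bracket x ^ (k + l) = w * c.outCdf k x := by
  rw [outCdf, orderCdf, bracket_eq_gainCdf c hc.one_le_Q hx, Finset.mul_sum, Finset.mul_sum]
  exact Finset.sum_congr rfl fun l _ => by ring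

lemma Valid.sopApprox_eq (hc : c.Valid) (hk : 1 ≤ k) (hkK : k ≤ c.K) (hR : 0 < R)
    (hadm : c.varsigma R k * c.ν k < c.a k) (hϖ : 0 ≤ ϖ) (hρ : 0 < ρ) (S D : ℕ) :
    c.sopApprox ϖ R k S D ρ = ∑ s ∈ laguerreNodes S, ∑ d ∈ laguerreNodes D,
      laguerreWeight S s * laguerreWeight D d * c.outCdf k (c.outArg ϖ R k ρ s d) := by
  rw [sopApprox]
  refine Finset.sum_congr rfl fun s hs => ?_
  rw [Finset.sum_comm]
  refine Finset.sum_congr rfl fun d hd => ?_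
  rw [← hc.sum_bracket_eq (hc.outArg_pos hk hkK hR hadm hϖ hρ (laguerreNodes_pos hs).le
    (laguerreNodes_pos hd).le)]
  simp only [← mul_assoc]
  rfl

lemma Valid.sopAsyIpsic_eq (hc : c.Valid) (hk : 1 ≤ k) (hkK : k ≤ c.K) (hR : 0 < R)
    (hadm : c.varsigma R k * c.ν k < c.a k) (hϖ : 0 < ϖ) (S D : ℕ) :
    c.sopAsyIpsic ϖ R k S D = ∑ s ∈ laguerreNodes S, ∑ d ∈ laguerreNodes D,
      laguerreWeight S s * laguerreWeight D d * c.outCdf k (c.outArgLim ϖ R k s d) := by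
  rw [sopAsyIpsic]
  refine Finset.sum_congr rfl fun s hs => ?_
  rw [Finset.sum_comm]
  refine Finset.sum_congr rfl fun d hd => ?_
  rw [← hc.sum_bracket_eq (hc.outArgLim_pos hk hkK hR hadm hϖ (laguerreNodes_pos hs).le
    (laguerreNodes_pos hd))]
  simp only [← mul_assoc]
  rfl

lemma Valid.tendsto_sopApprox (hc : c.Valid) (hk : 1 ≤ k) (hkK : k ≤ c.K) (hR : 0 < R)
    (hadm : c.varsigma R k * c.ν k < c.a k) (hϖ : 0 < ϖ) (S D : ℕ) :
    Tendsto (fun ρ => c.sopApprox ϖ R k S D ρ) atTop (𝓝 (c.sopAsyIpsic ϖ R k S D)) := by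
  rw [hc.sopAsyIpsic_eq hk hkK hR hadm hϖ]
  have h : Tendsto (fun ρ => ∑ s ∈ laguerreNodes S, ∑ d ∈ laguerreNodes D,
      laguerreWeight S s * laguerreWeight D d * c.outCdf k (c.outArg ϖ R k ρ s d)) atTop
      (𝓝 (∑ s ∈ laguerreNodes S, ∑ d ∈ laguerreNodes D,
      laguerreWeight S s * laguerreWeight D d * c.outCdf k (c.outArgLim ϖ R k s d))) :=
    tendsto_finsetSum _ fun s _ => tendsto_finsetSum _ fun d _ =>
      (((hc.continuous_outCdf k).tendsto _).comp (hc.tendsto_outArg hk hkK ϖ R s d)).const_mul _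
  refine h.congr' ?_
  filter_upwards [eventually_gt_atTop 0] with ρ hρ
  rw [hc.sopApprox_eq hk hkK hR hadm hϖ.le hρ]

/-- Weak convergence needs a test function continuous on the whole plane, but the denominators are
controlled only for nonnegative arguments. Clamping costs nothing, as both the nodes and the
exponential law live in the positive quadrant. -/
lemma Valid.continuous_outArgLim_max (hc : c.Valid) (hk : 1 ≤ k) (hkK : k ≤ c.K)
    (hadm : c.varsigma R k * c.ν k < c.a k) (hϖ : 0 ≤ ϖ) :
    Continuous fun z : ℝ × ℝ => c.outArgLim ϖ R k (max z.1 0) (max z.2 0) := by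
  have hϑ : Continuous fun z : ℝ × ℝ => c.vartheta ϖ R k (max z.1 0) := by
    unfold vartheta
    refine Continuous.sub (continuous_const.mul (continuous_const.add
      (Continuous.div (by fun_prop) (by fun_prop) fun z => ?_))) continuous_const
    exact (hc.vartheta_den_pos hk hkK hϖ (le_max_right _ _)).ne'
  unfold outArgLim
  refine Continuous.div (by fun_prop) (by fun_prop) fun z => ?_
  have h1 := hc.sub_vartheta_mul_pos hk hkK hadm hϖ (le_max_right z.1 0)
  have h2 := hc.Nr_pos k hk hkK
  have h3 := hc.Nbr_pos
  positivity

lemma Valid.tendsto_sopAsyIpsic (hc : c.Valid) (hk : 1 ≤ k) (hkK : k ≤ c.K) (hR : 0 < R)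
    (hadm : c.varsigma R k * c.ν k < c.a k) (hϖ : 0 < ϖ) :
    Tendsto (fun n : ℕ × ℕ => c.sopAsyIpsic ϖ R k n.1 n.2) (atTop ×ˢ atTop)
      (𝓝 (c.sopLim ϖ R k)) := by
  set g : BoundedContinuousFunction (ℝ × ℝ) ℝ := BoundedContinuousFunction.ofNormedAddCommGroup
    (fun z => c.outCdf k (c.outArgLim ϖ R k (max z.1 0) (max z.2 0)))
    ((hc.continuous_outCdf k).comp (hc.continuous_outArgLim_max hk hkK hadm hϖ.le)) 1
    (fun z => hc.norm_outCdf_le_one hk hkK _) with hg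
  have hgz : ∀ z : ℝ × ℝ, 0 < z.1 → 0 < z.2 → g z = c.outCdf k (c.outArgLim ϖ R k z.1 z.2) := by
    intro z h1 h2
    simp only [hg, BoundedContinuousFunction.coe_ofNormedAddCommGroup, max_eq_left h1.le,
      max_eq_left h2.le]
  have h := tendsto_sum_laguerre_mul g
  have hL : ∫ z, g z ∂(expMeasure 1).prod (expMeasure 1) = c.sopLim ϖ R k := by
    refine integral_congr_ae ?_
    filter_upwards [expMeasure_prod_ae_pos] with z hz using hgz z hz.1 hz.2
  rw [hL] at h
  refine h.congr fun n => ?_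
  rw [hc.sopAsyIpsic_eq hk hkK hR hadm hϖ]
  exact Finset.sum_congr rfl fun s hs => Finset.sum_congr rfl fun d hd => by
    rw [hgz (s, d) (laguerreNodes_pos hs) (laguerreNodes_pos hd)]

/-! ### Perfect SIC: first-order asymptotics. -/

lemma outArg_zero (c : Params) (R : ℝ) (k : ℕ) (ρ s d : ℝ) :
    c.outArg 0 R k ρ s d = c.u R k ρ := by
  simp [outArg, u, vartheta, varsigma, ζ₂]

lemma Valid.sop_zero_eq (hc : c.Valid) (hk : 1 ≤ k) (hkK : k ≤ c.K) (hR : 0 < R)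
    (hadm : c.varsigma R k * c.ν k < c.a k) (hρ : 0 < ρ) :
    c.sop 0 R k ρ = c.outCdf k (c.u R k ρ) := by
  rw [hc.sop_eq hk hkK hR hadm le_rfl hρ]
  simp [outArg_zero]

lemma Valid.tendsto_u (hc : c.Valid) (hk : 1 ≤ k) (hkK : k ≤ c.K) (hR : 0 < R)
    (hadm : c.varsigma R k * c.ν k < c.a k) :
    Tendsto (fun ρ => c.u R k ρ) atTop (𝓝[>] 0) := by
  refine tendsto_nhdsWithin_iff.2 ⟨?_, ?_⟩
  · have := hc.tendsto_outArg hk hkK 0 R 0 0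
    simpa only [outArg_zero, outArgLim, mul_zero, zero_mul, zero_div] using this
  · filter_upwards [eventually_gt_atTop 0] with ρ hρ
    have := hc.outArg_pos hk hkK hR hadm le_rfl hρ (le_refl (0 : ℝ)) (le_refl (0 : ℝ))
    rwa [outArg_zero] at this

/-- A first-order equivalent of the distribution function of the gain yields one of the outage
probability without residual interference. -/
lemma Valid.isEquivalent_sop_zero (hc : c.Valid) (hk : 1 ≤ k) (hkK : k ≤ c.K) (hR : 0 < R)
    (hadm : c.varsigma R k * c.ν k < c.a k) {v : ℝ → ℝ}
    (hv : Tendsto (fun u => gainCdf c.Q u / v u) (𝓝[>] 0) (𝓝 1)) :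
    Asymptotics.IsEquivalent atTop (fun ρ => c.sop 0 R k ρ)
      (fun ρ => c.κ k / k * v (c.u R k ρ) ^ k) := by
  have hu := hc.tendsto_u hk hkK hR hadm
  have hgain : Tendsto (gainCdf c.Q) (𝓝[>] 0) (𝓝[>] 0) := by
    refine tendsto_nhdsWithin_iff.2 ⟨?_, ?_⟩
    · have := (continuous_gainCdf hc.one_le_Q).tendsto 0
      rw [gainCdf_of_nonpos _ le_rfl] at this
      exact this.mono_left nhdsWithin_le_nhds
    · filter_upwards [self_mem_nhdsWithin] with x hx using gainCdf_pos hc.one_le_Q hx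
  have h1 : Asymptotics.IsEquivalent (𝓝[>] 0) (c.outCdf k)
      (fun x => c.κ k / k * gainCdf c.Q x ^ k) :=
    Asymptotics.isEquivalent_of_tendsto_one ((tendsto_orderCdf_div c hk).comp hgain)
  have h2 : Asymptotics.IsEquivalent (𝓝[>] 0) (gainCdf c.Q) v :=
    Asymptotics.isEquivalent_of_tendsto_one hv
  have h3 := (h1.trans ((Asymptotics.IsEquivalent.refl
    (u := fun _ : ℝ => c.κ k / k)).mul (h2.pow k))).comp_tendsto hu
  refine Asymptotics.IsEquivalent.congr_left h3 ?_
  filter_upwards [eventually_gt_atTop 0] with ρ hρ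
  rw [hc.sop_zero_eq hk hkK hR hadm hρ]
  rfl

end Params

end RisNoma

theorem corollary2 (c : RisNoma.Params) (hc : c.Valid) (k : ℕ) (hk : 2 ≤ k) (hkK : k ≤ c.K)
    (R : ℝ) (hR : 0 < R) (hadm : c.varsigma R k * c.ν k < c.a k) :
    (∀ ϖ : ℝ, 0 < ϖ → ϖ ≤ 1 →
      (∀ S D : ℕ, Tendsto (fun ρ : ℝ => c.sopApprox ϖ R k S D ρ) atTop
        (𝓝 (c.sopAsyIpsic ϖ R k S D))) ∧
      ∃ L : ℝ, 0 < L ∧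
        Tendsto (fun ρ : ℝ => c.sop ϖ R k ρ) atTop (𝓝 L) ∧
        Tendsto (fun n : ℕ × ℕ => c.sopAsyIpsic ϖ R k n.1 n.2) (atTop ×ˢ atTop) (𝓝 L)) ∧
    (c.Q = 1 → Asymptotics.IsEquivalent atTop
      (fun ρ : ℝ => c.sop 0 R k ρ) (fun ρ : ℝ => c.sopAsyPsicOne R k ρ)) ∧
    (2 ≤ c.Q → Asymptotics.IsEquivalent atTop
      (fun ρ : ℝ => c.sop 0 R k ρ) (fun ρ : ℝ => c.sopAsyPsicTwo R k ρ)) := by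
  have hk1 : 1 ≤ k := by omega
  refine ⟨fun ϖ hϖ _ => ⟨hc.tendsto_sopApprox hk1 hkK hR hadm hϖ, c.sopLim ϖ R k,
    hc.sopLim_pos hk1 hkK hR hadm hϖ, hc.tendsto_sop hk1 hkK hR hadm hϖ.le,
    hc.tendsto_sopAsyIpsic hk1 hkK hR hadm hϖ⟩, fun hQ => ?_, fun hQ => ?_⟩
  -- Since `Γ(1) = 1`, the bracket `1 - (1 + u log u)` of the stated formula is exactly this `v`.
  · have h := hc.isEquivalent_sop_zero hk1 hkK hR hadm (v := fun u => -(u * Real.log u))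
      (by rw [hQ]; exact RisNoma.tendsto_gainCdf_one_div)
    convert h using 2 with ρ
    rw [RisNoma.Params.sopAsyPsicOne, hQ, Nat.cast_one, Real.Gamma_one]
    ring
  · have hQ1 : (0 : ℝ) < (c.Q : ℝ) - 1 := by
      have : (2 : ℝ) ≤ c.Q := by exact_mod_cast hQ
      linarith
    have h := hc.isEquivalent_sop_zero hk1 hkK hR hadm (v := fun u => u / ((c.Q : ℝ) - 1)) (by
      have h1 := (RisNoma.tendsto_gainCdf_div hQ).mul_const ((c.Q : ℝ) - 1)
      rw [one_div, inv_mul_cancel₀ hQ1.ne'] at h1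
      refine h1.congr fun u => ?_
      rw [div_div_eq_mul_div, div_mul_eq_mul_div])
    convert h using 2 with ρ
    rw [RisNoma.Params.sopAsyPsicTwo, RisNoma.Params.u, mul_comm (c.ν k)]
    congr 2
    simp only [div_eq_mul_inv, mul_inv]
    ring
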